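/- Let $q\in\mathbb{C}^\times$ not be a root of unity. Let $\mathcal{O}_q(\mathrm{Mat}_2)$ be the $\mathbb{C}$-algebra generated by $a,b,c,d$ with relations $$ab=qba,\quad ac=qca,\quad bc=cb,\quad bd=qdb,\quad cd=qdc,\quad ad-da=(q-q^{-1})bc,$$ and let $\mathcal{O}_q(\mathrm{SL}_2)=\mathcal{O}_q(\mathrm{Mat}_2)/\langle ad-qbc-1\rangle$. Let $U_q(\mathfrak{sl}_2)$ be generated by $E,F,K^{\pm1}$ with relations $KE=q^2EK$, $KF=q^{-2}FK$, $EF-FE=(K-K^{-1})/(q-q^{-1})$ and comultiplication $\Delta(E)=E\otimes 1+K\otimes E$, $\Delta(F)=F\otimes K^{-1}+1\otimes F$, $\Delta(K)=K\otimes K$, and for $m\ge 0$ let $\mathcal{V}_m$ be its simple module of type $\mathbf 1$ and dimension $m+1$. Identify $\mathcal{O}_q(\mathrm{SL}_2)$ with the algebra of matrix coefficients in $U_q(\mathfrak{sl}_2)^*$ by sending $a,b,c,d$ to the entries $c_{11},c_{12},c_{21},c_{22}$ of the matrix of $\mathcal{V}_1$ in a weight basis $v_1,\ v_2=Fv_1$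 with $v_1$ of highest weight. For $n\in\mathbb{Z}$ let $\mathcal{O}_q(\mathrm{SL}_2)_{\le n}$ be the span of the matrix coefficients of the modules $\mathcal{V}_m$ with $m\le n$ in the dominance order on $\mathbb{Z}$ (that is, $n-m$ is a nonnegative even integer), and let $\mathcal{O}_q(\mathrm{SL}_2)_{<n}=\sum_{m<n}\mathcal{O}_q(\mathrm{SL}_2)_{\le m}$. Let $\mathrm{Sym}_q^k(\mathbb{C}^2)$ be the component of degree $k$ of $\mathbb{C}\langle x,y\rangle/\langle xy-qyx\rangle$, and for the second copy of this algebra write $(u,w)$ for $(x,y)$. Then these subspaces form an algebra filtration of $\mathcal{O}_q(\mathrm{SL}_2)$ by $\mathbb{Z}$ with the dominance order (the Peter–Weyl filtration), and there are isomorphisms of graded $\mathbb{C}$-algebras $$\mathrm{gr}(\mathcal{O}_q(\mathrm{SL}_2))=\bigoplus_{n\in\mathbb{Z}}\mathcal{O}_q(\mathrm{SL}_2)_{\le n}/\mathcal{O}_q(\mathrm{SL}_2)_{<n}\;\simeq\;\mathcal{O}_q(\mathrm{Mat}_2)/\langle ad-qbc\rangle\;\simeq\;\bigoplus_{k\ge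 0}\mathrm{Sym}_q^k(\mathbb{C}^2)\otimes\mathrm{Sym}_q^k(\mathbb{C}^2),$$ where the generators $a,b,c,d$ of the middle algebra have degree $1$. The first isomorphism sends the classes of $a,b,c,d\in\mathcal{O}_q(\mathrm{SL}_2)_{\le 1}$ to $a,b,c,d$, and the second is given by $a\mapsto x\otimes u$, $b\mapsto x\otimes w$, $c\mapsto y\otimes u$, $d\mapsto y\otimes w$. The last algebra is called $\mathbb{P}^1_q\times\mathbb{P}^1_q$. -/

import Mathlib

open scoped TensorProduct DirectSum

noncomputable section

namespace QuantumSL2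

section AssociatedGraded

variable {ι k A : Type*} [PartialOrder ι] [CommRing k] [Ring A] [Algebra k A]

/-- `F_{< i}`, the sum of the `F_j` with `j < i`. -/
def filtrationLT (F : ι → Submodule k A) (i : ι) : Submodule k A := ⨆ j, ⨆ _ : j < i, F j

/-- The component `F_i / F_{< i}` of the associated graded algebra. -/
def GrPiece (F : ι → Submodule k A) (i : ι) : Type _ :=
  F i ⧸ (filtrationLT F i).submoduleOf (F i)

instance (F : ι → Submodule k A) (i : ι) : AddCommGroup (GrPiece F i) :=
  inferInstanceAs (AddCommGroup (F i ⧸ (filtrationLT F i).submoduleOf (F i)))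

instance (F : ι → Submodule k A) (i : ι) : Module k (GrPiece F i) :=
  inferInstanceAs (Module k (F i ⧸ (filtrationLT F i).submoduleOf (F i)))

/-- The symbol in `F_i / F_{< i}` of an element of `F_i`. -/
def grMk (F : ι → Submodule k A) (i : ι) : F i →ₗ[k] GrPiece F i :=
  ((filtrationLT F i).submoduleOf (F i)).mkQ

variable (F : ι → Submodule k A)

theorem grMk_surjective (i : ι) : Function.Surjective (grMk F i) :=
  Submodule.mkQ_surjective _

theorem grMk_congr {i j : ι} (h : i = j) (x : F i) (y : F j) (hxy : (x : A) = y) :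
    GradedMonoid.mk (A := GrPiece F) i (grMk F i x) = GradedMonoid.mk j (grMk F j y) := by
  subst h
  rw [Subtype.ext hxy]

variable [AddCommMonoid ι] [IsOrderedCancelAddMonoid ι] [IsRingFiltration F (filtrationLT F)]

theorem filtrationLT_mul_mem {i j : ι} {x y : A} (hx : x ∈ filtrationLT F i) (hy : y ∈ F j) :
    x * y ∈ filtrationLT F (i + j) := by
  have : filtrationLT F i ≤ (filtrationLT F (i + j)).comap (LinearMap.mulRight k y) :=
    iSup₂_le fun l hl z hz =>
      IsFiltration.is_le (F := F) (add_lt_add_left hl j) (SetLike.mul_mem_graded hz hy)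
  exact this hx

theorem mul_filtrationLT_mem {i j : ι} {x y : A} (hx : x ∈ F i) (hy : y ∈ filtrationLT F j) :
    x * y ∈ filtrationLT F (i + j) := by
  have : filtrationLT F j ≤ (filtrationLT F (i + j)).comap (LinearMap.mulLeft k x) :=
    iSup₂_le fun l hl z hz =>
      IsFiltration.is_le (F := F) (add_lt_add_right hl i) (SetLike.mul_mem_graded hx hz)
  exact this hy

/-- The multiplication `F_i × F_j → F_{i+j}`. -/
def filtrationMul (i j : ι) : F i →ₗ[k] F j →ₗ[k] F (i + j) :=
  LinearMap.mk₂ k (fun x y => ⟨x * y, SetLike.mul_mem_graded x.2 y.2⟩)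
    (fun _ _ _ => Subtype.ext (add_mul _ _ _)) (fun _ _ _ => Subtype.ext (smul_mul_assoc _ _ _))
    (fun _ _ _ => Subtype.ext (mul_add _ _ _)) (fun _ _ _ => Subtype.ext (mul_smul_comm _ _ _))

/-- The multiplication `F_i / F_{< i} × F_j / F_{< j} → F_{i+j} / F_{< i+j}`. -/
def grMul (i j : ι) : GrPiece F i →ₗ[k] GrPiece F j →ₗ[k] GrPiece F (i + j) :=
  Submodule.liftQ _
    (LinearMap.flip (Submodule.liftQ _
      (LinearMap.flip ((filtrationMul F i j).compr₂ (grMk F (i + j))))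
      (fun y hy => by
        refine LinearMap.ext fun x => ?_
        exact (Submodule.Quotient.mk_eq_zero _).2 (mul_filtrationLT_mem F x.2 hy))))
    (fun x hx => by
      refine LinearMap.ext fun y => ?_
      obtain ⟨y, rfl⟩ := grMk_surjective F _ y
      exact (Submodule.Quotient.mk_eq_zero _).2 (filtrationLT_mul_mem F hx y.2))

instance : GradedMonoid.GMul (GrPiece F) := ⟨fun x y => grMul F _ _ x y⟩

instance : GradedMonoid.GOne (GrPiece F) := ⟨grMk F 0 ⟨1, SetLike.one_mem_graded F⟩⟩

theorem grMk_mul (i j : ι) (x : F i) (y : F j) :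
    GradedMonoid.GMul.mul (A := GrPiece F) (grMk F i x) (grMk F j y) =
      grMk F (i + j) ⟨x * y, SetLike.mul_mem_graded x.2 y.2⟩ := rfl

instance : DirectSum.GRing (GrPiece F) where
  mul_zero _ := map_zero _
  zero_mul _ := LinearMap.map_zero₂ _ _
  mul_add _ _ _ := map_add _ _ _
  add_mul _ _ _ := LinearMap.map_add₂ _ _ _ _
  one_mul := by
    rintro ⟨i, x⟩
    obtain ⟨x, rfl⟩ := grMk_surjective F _ x
    exact grMk_congr F (zero_add i) _ x (one_mul _)
  mul_one := by
    rintro ⟨i, x⟩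
    obtain ⟨x, rfl⟩ := grMk_surjective F _ x
    exact grMk_congr F (add_zero i) _ x (mul_one _)
  mul_assoc := by
    rintro ⟨i, x⟩ ⟨j, y⟩ ⟨l, z⟩
    obtain ⟨x, rfl⟩ := grMk_surjective F _ x
    obtain ⟨y, rfl⟩ := grMk_surjective F _ y
    obtain ⟨z, rfl⟩ := grMk_surjective F _ z
    exact grMk_congr F (add_assoc i j l) _ _ (mul_assoc _ _ _)
  natCast n := n • GradedMonoid.GOne.one
  natCast_zero := zero_smul _ _
  natCast_succ n := succ_nsmul _ _
  intCast n := n • GradedMonoid.GOne.one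
  intCast_ofNat n := natCast_zsmul _ _
  intCast_negSucc_ofNat n := negSucc_zsmul _ _

instance : DirectSum.GAlgebra k (GrPiece F) where
  toFun := (grMk F 0 ∘ₗ (Algebra.linearMap k A).codRestrict (F 0)
    (SetLike.algebraMap_mem_graded F)).toAddMonoidHom
  map_one := congrArg (grMk F 0) (Subtype.ext (map_one (algebraMap k A)))
  map_mul _ _ := grMk_congr F (add_zero 0).symm _ _ (map_mul (algebraMap k A) _ _)
  commutes := by
    rintro r ⟨i, x⟩
    obtain ⟨x, rfl⟩ := grMk_surjective F _ x
    exact grMk_congr F ((zero_add i).trans (add_zero i).symm) _ _ (Algebra.commutes r (x : A))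
  smul_def := by
    rintro r ⟨i, x⟩
    obtain ⟨x, rfl⟩ := grMk_surjective F _ x
    exact grMk_congr F (zero_add i).symm (r • x) _ (Algebra.smul_def r (x : A))

/-- The associated graded algebra `⨁ᵢ F_i / F_{< i}`. -/
abbrev AssocGraded : Type _ := ⨁ i, GrPiece F i

variable [DecidableEq ι]

/-- The symbol of `x ∈ F_i`, as an element of the associated graded algebra. -/
def grOf (i : ι) (x : F i) : AssocGraded F := DirectSum.of (GrPiece F) i (grMk F i x)

/-- The homogeneous component of degree `i` of the associated graded algebra. -/
def grComponent (i : ι) : Submodule k (AssocGraded F) :=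
  LinearMap.range (DirectSum.lof k ι (GrPiece F) i)

end AssociatedGraded
section Presented

universe u

variable {A : Type u} [Ring A] [Algebra ℂ A]

/-- The quotient of a `ℂ`-algebra by the two-sided ideal generated by the elements `x - y` for
`r x y`. -/
def Presented (r : A → A → Prop) : Type u := RingQuot r

variable (r : A → A → Prop)

instance : Ring (Presented r) := inferInstanceAs (Ring (RingQuot r))

instance : Algebra ℂ (Presented r) := inferInstanceAs (Algebra ℂ (RingQuot r))

/-- The quotient morphism. -/
def Presented.mk : A →ₐ[ℂ] Presented r := RingQuot.mkAlgHom ℂ r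

variable {r}

theorem Presented.mk_rel {x y : A} (h : r x y) : Presented.mk r x = Presented.mk r y :=
  RingQuot.mkAlgHom_rel ℂ h

theorem Presented.mk_surjective : Function.Surjective (Presented.mk r) :=
  RingQuot.mkAlgHom_surjective ℂ r

/-- The universal property of the quotient. -/
def Presented.lift {B : Type*} [Ring B] [Algebra ℂ B] (f : A →ₐ[ℂ] B)
    (h : ∀ ⦃x y⦄, r x y → f x = f y) : Presented r →ₐ[ℂ] B :=
  RingQuot.liftAlgHom ℂ ⟨f, h⟩

@[simp]
theorem Presented.lift_mk {B : Type*} [Ring B] [Algebra ℂ B] (f : A →ₐ[ℂ] B)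
    (h : ∀ ⦃x y⦄, r x y → f x = f y) (x : A) :
    Presented.lift f h (Presented.mk r x) = f x :=
  RingQuot.liftAlgHom_mkAlgHom_apply ℂ f h x

theorem Presented.hom_ext {B : Type*} [Semiring B] [Algebra ℂ B] {φ ψ : Presented r →ₐ[ℂ] B}
    (h : φ.comp (Presented.mk r) = ψ.comp (Presented.mk r)) : φ = ψ :=
  RingQuot.ringQuot_ext' _ _ _ h

end Presented

section QuantizedEnvelopingAlgebra

/-- Names for the generators `E`, `F`, `K`, `K⁻¹` of `U_q(𝔰𝔩₂)`. -/
inductive UqGen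
  | E | F | K | Kinv

/-- The defining relations of `U_q(𝔰𝔩₂)`. -/
inductive UqRel (q : ℂˣ) : FreeAlgebra ℂ UqGen → FreeAlgebra ℂ UqGen → Prop
  | K_Kinv : UqRel q (FreeAlgebra.ι ℂ .K * FreeAlgebra.ι ℂ .Kinv) 1
  | Kinv_K : UqRel q (FreeAlgebra.ι ℂ .Kinv * FreeAlgebra.ι ℂ .K) 1
  | K_E : UqRel q (FreeAlgebra.ι ℂ .K * FreeAlgebra.ι ℂ .E)
      ((q : ℂ) ^ 2 • (FreeAlgebra.ι ℂ .E * FreeAlgebra.ι ℂ .K))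
  | K_F : UqRel q (FreeAlgebra.ι ℂ .K * FreeAlgebra.ι ℂ .F)
      (((q : ℂ) ^ 2)⁻¹ • (FreeAlgebra.ι ℂ .F * FreeAlgebra.ι ℂ .K))
  | E_F : UqRel q
      (FreeAlgebra.ι ℂ .E * FreeAlgebra.ι ℂ .F - FreeAlgebra.ι ℂ .F * FreeAlgebra.ι ℂ .E)
      (((q : ℂ) - (q : ℂ)⁻¹)⁻¹ • (FreeAlgebra.ι ℂ .K - FreeAlgebra.ι ℂ .Kinv))

/-- The quantized enveloping algebra `U_q(𝔰𝔩₂)`. -/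
abbrev Uq (q : ℂˣ) : Type := Presented (UqRel q)

/-- The generators of `U_q(𝔰𝔩₂)`. -/
def Uq.gen (q : ℂˣ) (g : UqGen) : Uq q := Presented.mk (UqRel q) (FreeAlgebra.ι ℂ g)

variable (q : ℂˣ)

theorem Uq.K_Kinv : Uq.gen q .K * Uq.gen q .Kinv = 1 := by
  simpa [Uq.gen] using Presented.mk_rel (UqRel.K_Kinv (q := q))

theorem Uq.Kinv_K : Uq.gen q .Kinv * Uq.gen q .K = 1 := by
  simpa [Uq.gen] using Presented.mk_rel (UqRel.Kinv_K (q := q))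

theorem Uq.K_E : Uq.gen q .K * Uq.gen q .E = (q : ℂ) ^ 2 • (Uq.gen q .E * Uq.gen q .K) := by
  simpa [Uq.gen] using Presented.mk_rel (UqRel.K_E (q := q))

theorem Uq.K_F : Uq.gen q .K * Uq.gen q .F = ((q : ℂ) ^ 2)⁻¹ • (Uq.gen q .F * Uq.gen q .K) := by
  simpa [Uq.gen] using Presented.mk_rel (UqRel.K_F (q := q))

theorem Uq.E_F : Uq.gen q .E * Uq.gen q .F - Uq.gen q .F * Uq.gen q .E =
    ((q : ℂ) - (q : ℂ)⁻¹)⁻¹ • (Uq.gen q .K - Uq.gen q .Kinv) := by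
  simpa [Uq.gen] using Presented.mk_rel (UqRel.E_F (q := q))

variable {q} in
/-- The algebra morphism out of `U_q(𝔰𝔩₂)` with prescribed values on the generators. -/
def Uq.lift {B : Type*} [Ring B] [Algebra ℂ B] (f : UqGen → B)
    (h₁ : f .K * f .Kinv = 1) (h₂ : f .Kinv * f .K = 1)
    (h₃ : f .K * f .E = (q : ℂ) ^ 2 • (f .E * f .K))
    (h₄ : f .K * f .F = ((q : ℂ) ^ 2)⁻¹ • (f .F * f .K))
    (h₅ : f .E * f .F - f .F * f .E = ((q : ℂ) - (q : ℂ)⁻¹)⁻¹ • (f .K - f .Kinv)) :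
    Uq q →ₐ[ℂ] B :=
  Presented.lift (FreeAlgebra.lift ℂ f) (by
    rintro _ _ (_ | _ | _ | _ | _) <;> simpa)

variable {q} in
@[simp]
theorem Uq.lift_gen {B : Type*} [Ring B] [Algebra ℂ B] (f : UqGen → B) (h₁ h₂ h₃ h₄ h₅)
    (g : UqGen) : Uq.lift (q := q) f h₁ h₂ h₃ h₄ h₅ (Uq.gen q g) = f g := by
  simp [Uq.lift, Uq.gen]

variable {q} in
theorem Uq.algHom_ext {B : Type*} [Semiring B] [Algebra ℂ B] {φ ψ : Uq q →ₐ[ℂ] B}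
    (h : ∀ g, φ (Uq.gen q g) = ψ (Uq.gen q g)) : φ = ψ :=
  Presented.hom_ext (FreeAlgebra.hom_ext (funext h))

theorem Uq.Kinv_E : Uq.gen q .E * Uq.gen q .Kinv =
    (q : ℂ) ^ 2 • (Uq.gen q .Kinv * Uq.gen q .E) := by
  have h := congrArg (fun t => Uq.gen q .Kinv * t * Uq.gen q .Kinv) (Uq.K_E q)
  simp only [mul_smul_comm, smul_mul_assoc] at h
  rw [← mul_assoc, Uq.Kinv_K, one_mul, mul_assoc, mul_assoc, Uq.K_Kinv, mul_one] at h
  exact h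

/-- The comultiplication: `Δ(E) = E ⊗ 1 + K ⊗ E`, `Δ(F) = F ⊗ K⁻¹ + 1 ⊗ F`,
`Δ(K^{±1}) = K^{±1} ⊗ K^{±1}`. -/
def Uq.comulGen : UqGen → Uq q ⊗[ℂ] Uq q
  | .E => Uq.gen q .E ⊗ₜ 1 + Uq.gen q .K ⊗ₜ Uq.gen q .E
  | .F => Uq.gen q .F ⊗ₜ Uq.gen q .Kinv + 1 ⊗ₜ Uq.gen q .F
  | .K => Uq.gen q .K ⊗ₜ Uq.gen q .K
  | .Kinv => Uq.gen q .Kinv ⊗ₜ Uq.gen q .Kinv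

/-- The comultiplication of `U_q(𝔰𝔩₂)`. -/
def Uq.comul : Uq q →ₐ[ℂ] Uq q ⊗[ℂ] Uq q :=
  Uq.lift (Uq.comulGen q)
    (by simp [Uq.comulGen, Uq.K_Kinv, Algebra.TensorProduct.one_def])
    (by simp [Uq.comulGen, Uq.Kinv_K, Algebra.TensorProduct.one_def])
    (by simp [Uq.comulGen, mul_add, add_mul, Uq.K_E, TensorProduct.smul_tmul'])
    (by simp [Uq.comulGen, mul_add, add_mul, Uq.K_F, TensorProduct.smul_tmul',
          Uq.K_Kinv, Uq.Kinv_K])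
    (by
      have hq : (q : ℂ) ≠ 0 := q.ne_zero
      have hEF : Uq.gen q .E * Uq.gen q .F = Uq.gen q .F * Uq.gen q .E +
          ((q : ℂ) - (q : ℂ)⁻¹)⁻¹ • (Uq.gen q .K - Uq.gen q .Kinv) := by
        rw [← Uq.E_F]; abel
      simp only [Uq.comulGen, mul_add, add_mul, Algebra.TensorProduct.tmul_mul_tmul, one_mul,
        mul_one, Uq.K_F, Uq.Kinv_E, hEF]
      simp only [TensorProduct.add_tmul, TensorProduct.tmul_add, TensorProduct.sub_tmul,
        TensorProduct.tmul_sub, ← TensorProduct.smul_tmul', TensorProduct.tmul_smul, smul_sub,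
        smul_smul]
      rw [mul_inv_cancel₀ (pow_ne_zero 2 hq), one_smul]
      abel)

/-- The counit of `U_q(𝔰𝔩₂)`. -/
def Uq.counit : Uq q →ₐ[ℂ] ℂ :=
  Uq.lift (fun | .E => 0 | .F => 0 | .K => 1 | .Kinv => 1)
    (by simp) (by simp) (by simp) (by simp) (by simp)

instance : Bialgebra ℂ (Uq q) :=
  Bialgebra.ofAlgHom (Uq.comul q) (Uq.counit q)
    (Uq.algHom_ext fun g => by
      cases g <;> simp [Uq.comul, Uq.comulGen, TensorProduct.tmul_add, TensorProduct.add_tmul,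
        Algebra.TensorProduct.one_def, add_assoc])
    (Uq.algHom_ext fun g => by
      cases g <;> simp [Uq.comul, Uq.counit, Uq.comulGen])
    (Uq.algHom_ext fun g => by
      cases g <;> simp [Uq.comul, Uq.counit, Uq.comulGen])

/-- The quantum integer `[n] = (qⁿ - q⁻ⁿ) / (q - q⁻¹)`. -/
def qInt (n : ℤ) : ℂ := ((q : ℂ) ^ n - (q : ℂ) ^ (-n)) / ((q : ℂ) - (q : ℂ)⁻¹)

/-- The matrices of the generators on the simple module `V_m` with basis `v_0, …, v_m`:
`K v_j = q^{m-2j} v_j`, `E v_j = [m-j+1] v_{j-1}`, `F v_j = [j+1] v_{j+1}`. -/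
def irrepGen (m : ℕ) : UqGen → Matrix (Fin (m + 1)) (Fin (m + 1)) ℂ
  | .E => .of fun i j => if (j : ℕ) = i + 1 then qInt q (m - j + 1) else 0
  | .F => .of fun i j => if (i : ℕ) = j + 1 then qInt q (j + 1) else 0
  | .K => .diagonal fun j => (q : ℂ) ^ ((m : ℤ) - 2 * j)
  | .Kinv => .diagonal fun j => (q : ℂ) ^ (-((m : ℤ) - 2 * j))

theorem qInt_zero : qInt q 0 = 0 := by simp [qInt]

theorem qInt_identity (a b : ℤ) : qInt q (a + 1) * qInt q b - qInt q (b + 1) * qInt q a =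
    ((q : ℂ) - (q : ℂ)⁻¹)⁻¹ * ((q : ℂ) ^ (b - a) - (q : ℂ) ^ (-(b - a))) := by
  have hq : (q : ℂ) ≠ 0 := q.ne_zero
  by_cases h : (q : ℂ) - (q : ℂ)⁻¹ = 0
  · simp [qInt, h]
  · have h' : (q : ℂ) ^ 2 - 1 ≠ 0 := by
      intro h0; apply h; field_simp; simpa using h0
    simp only [qInt, neg_add, neg_sub, zpow_add₀ hq, zpow_sub₀ hq, zpow_neg, zpow_one]
    have ha : (q : ℂ) ^ a ≠ 0 := zpow_ne_zero _ hq
    have hb : (q : ℂ) ^ b ≠ 0 := zpow_ne_zero _ hq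
    field_simp
    ring

theorem irrep_E_F (m : ℕ) :
    irrepGen q m .E * irrepGen q m .F - irrepGen q m .F * irrepGen q m .E =
      ((q : ℂ) - (q : ℂ)⁻¹)⁻¹ • (irrepGen q m .K - irrepGen q m .Kinv) := by
  have hEF : irrepGen q m .E * irrepGen q m .F =
      .diagonal fun i => qInt q (i + 1) * qInt q (m - i) := by
    ext i j
    simp only [irrepGen, Matrix.mul_apply, Matrix.of_apply, Matrix.diagonal_apply, ite_mul,
      mul_ite, zero_mul, mul_zero]
    rcases Nat.lt_or_ge (i : ℕ) m with hi | hi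
    · rw [Finset.sum_eq_single (⟨i + 1, by omega⟩ : Fin (m + 1))]
      · by_cases h : i = j
        · subst h
          simp only [Nat.cast_add, Nat.cast_one, if_true]
          rw [mul_comm]
          congr 2
          ring
        · have : (i : ℕ) ≠ j := fun h' => h (Fin.ext h')
          simp [h, this]
      · intro l _ hl
        have : (l : ℕ) ≠ i + 1 := fun h' => hl (Fin.ext h')
        simp [this]
      · simp
    · have hi' : (i : ℕ) = m := by omega
      rw [Finset.sum_eq_zero]
      · simp [hi', qInt_zero]
      · intro l _
        have : (l : ℕ) ≠ i + 1 := by omega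
        simp [this]
  have hFE : irrepGen q m .F * irrepGen q m .E =
      .diagonal fun i => qInt q (m - i + 1) * qInt q i := by
    ext i j
    simp only [irrepGen, Matrix.mul_apply, Matrix.of_apply, Matrix.diagonal_apply, ite_mul,
      mul_ite, zero_mul, mul_zero]
    rcases Nat.eq_zero_or_pos (i : ℕ) with hi | hi
    · rw [Finset.sum_eq_zero]
      · simp [hi, qInt_zero]
      · intro l _
        have : (i : ℕ) ≠ l + 1 := by omega
        simp [this]
    · obtain ⟨r, hr⟩ : ∃ r, (i : ℕ) = r + 1 := ⟨i - 1, by omega⟩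
      rw [Finset.sum_eq_single (⟨r, by omega⟩ : Fin (m + 1))]
      · by_cases h : i = j
        · subst h
          simp [hr, mul_comm]
        · have : (j : ℕ) ≠ r + 1 := fun h' => h (Fin.ext (by omega))
          simp [h, this]
      · intro l _ hl
        have : (i : ℕ) ≠ l + 1 := fun h' => hl (Fin.ext (by simp; omega))
        simp [this]
      · simp
  rw [hEF, hFE]
  ext i j
  by_cases h : i = j
  · subst h
    simp only [Matrix.sub_apply, Matrix.diagonal_apply_eq, Matrix.smul_apply, irrepGen,
      smul_eq_mul]
    rw [qInt_identity]
    ring_nf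
  · simp [irrepGen, h]

/-- The simple `U_q(𝔰𝔩₂)`-module `V_m` of type 1 and highest weight `m` (so of dimension `m + 1`),
as a morphism from `U_q(𝔰𝔩₂)` to matrices. -/
def irrepMatrix (m : ℕ) : Uq q →ₐ[ℂ] Matrix (Fin (m + 1)) (Fin (m + 1)) ℂ :=
  Uq.lift (irrepGen q m)
    (by
      have hq : (q : ℂ) ≠ 0 := q.ne_zero
      simp [irrepGen, ← zpow_add₀ hq])
    (by
      have hq : (q : ℂ) ≠ 0 := q.ne_zero
      simp [irrepGen, ← zpow_add₀ hq])
    (by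
      have hq : (q : ℂ) ≠ 0 := q.ne_zero
      ext i j
      simp only [irrepGen, Matrix.diagonal_mul, Matrix.smul_apply, Matrix.mul_diagonal,
        Matrix.of_apply, smul_eq_mul]
      split_ifs with h
      · rw [h, mul_comm, mul_left_comm, ← zpow_natCast, ← zpow_add₀ hq]
        congr 2
        push_cast
        ring
      · simp)
    (by
      have hq : (q : ℂ) ≠ 0 := q.ne_zero
      ext i j
      simp only [irrepGen, Matrix.diagonal_mul, Matrix.smul_apply, Matrix.mul_diagonal,
        Matrix.of_apply, smul_eq_mul]
      split_ifs with h
      · rw [h, mul_comm, mul_left_comm, ← zpow_natCast, ← zpow_neg, ← zpow_add₀ hq]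
        congr 2
        push_cast
        ring
      · simp)
    (irrep_E_F q m)

/-- The action of `U_q(𝔰𝔩₂)` on `V_m = ℂ^{m+1}`. -/
def irrep (m : ℕ) : Uq q →ₐ[ℂ] Module.End ℂ (Fin (m + 1) → ℂ) :=
  (Matrix.toLinAlgEquiv' : Matrix (Fin (m + 1)) (Fin (m + 1)) ℂ ≃ₐ[ℂ] _).toAlgHom.comp
    (irrepMatrix q m)

/-- The linear dual `U_q(𝔰𝔩₂)^*` with the product dual to the comultiplication. The Hopf dual is a
subalgebra of it. -/
abbrev UqDual : Type := WithConv (Uq q →ₗ[ℂ] ℂ)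

/-- The matrix coefficient `c_{f,v} : u ↦ f(u v)` of a module `M`. -/
def matrixCoeff {q : ℂˣ} {M : Type*} [AddCommGroup M] [Module ℂ M]
    (ρ : Uq q →ₐ[ℂ] Module.End ℂ M) (f : Module.Dual ℂ M) (v : M) : UqDual q :=
  WithConv.toConv (f ∘ₗ LinearMap.applyₗ v ∘ₗ ρ.toLinearMap)

end QuantizedEnvelopingAlgebra
section QuantumMatrices

/-- Names for the generators `a`, `b`, `c`, `d` of `O_q(Mat₂)`. -/
inductive MatGen
  | a | b | c | d

/-- The defining relations of `O_q(Mat₂)`. -/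
inductive MatRel (q : ℂˣ) : FreeAlgebra ℂ MatGen → FreeAlgebra ℂ MatGen → Prop
  | a_b : MatRel q (FreeAlgebra.ι ℂ .a * FreeAlgebra.ι ℂ .b)
      ((q : ℂ) • (FreeAlgebra.ι ℂ .b * FreeAlgebra.ι ℂ .a))
  | a_c : MatRel q (FreeAlgebra.ι ℂ .a * FreeAlgebra.ι ℂ .c)
      ((q : ℂ) • (FreeAlgebra.ι ℂ .c * FreeAlgebra.ι ℂ .a))
  | b_c : MatRel q (FreeAlgebra.ι ℂ .b * FreeAlgebra.ι ℂ .c)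
      (FreeAlgebra.ι ℂ .c * FreeAlgebra.ι ℂ .b)
  | b_d : MatRel q (FreeAlgebra.ι ℂ .b * FreeAlgebra.ι ℂ .d)
      ((q : ℂ) • (FreeAlgebra.ι ℂ .d * FreeAlgebra.ι ℂ .b))
  | c_d : MatRel q (FreeAlgebra.ι ℂ .c * FreeAlgebra.ι ℂ .d)
      ((q : ℂ) • (FreeAlgebra.ι ℂ .d * FreeAlgebra.ι ℂ .c))
  | a_d : MatRel q
      (FreeAlgebra.ι ℂ .a * FreeAlgebra.ι ℂ .d - FreeAlgebra.ι ℂ .d * FreeAlgebra.ι ℂ .a)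
      (((q : ℂ) - (q : ℂ)⁻¹) • (FreeAlgebra.ι ℂ .b * FreeAlgebra.ι ℂ .c))

variable (q : ℂˣ)

/-- The quantum matrix algebra `O_q(Mat₂)`. -/
abbrev OqMat : Type := Presented (MatRel q)

/-- The generators of `O_q(Mat₂)`. -/
def OqMat.gen (g : MatGen) : OqMat q := Presented.mk (MatRel q) (FreeAlgebra.ι ℂ g)

/-- The quantum determinant `ad - qbc`. -/
def qDet : OqMat q :=
  OqMat.gen q .a * OqMat.gen q .d - (q : ℂ) • (OqMat.gen q .b * OqMat.gen q .c)

/-- The relation `D_q = t`. -/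
inductive FibreRel (t : ℂ) : OqMat q → OqMat q → Prop
  | det : FibreRel t (qDet q) (algebraMap ℂ (OqMat q) t)

/-- The quotient of `O_q(Mat₂)` by the two-sided ideal generated by `D_q - t`. -/
abbrev OqFibre (t : ℂ) : Type := Presented (FibreRel q t)

/-- The images of the generators `a`, `b`, `c`, `d` in the quotient. -/
def OqFibre.gen (t : ℂ) (g : MatGen) : OqFibre q t := Presented.mk (FibreRel q t) (OqMat.gen q g)

/-- `O_q(SL₂) = O_q(Mat₂) / ⟨D_q - 1⟩`. -/
abbrev OqSL2 : Type := OqFibre q 1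

/-- `O_q(Mat₂) / ⟨ad - qbc⟩`. -/
abbrev OqSing : Type := OqFibre q 0

/-- The component of degree `n` of the graded algebra `O_q(Mat₂) / ⟨ad - qbc⟩`: the span of the
products of `n` generators. -/
def OqSing.component (n : ℕ) : Submodule ℂ (OqSing q) :=
  Submodule.span ℂ (Set.range (OqFibre.gen q 0)) ^ n

end QuantumMatrices

section PeterWeyl

variable (q : ℂˣ)

/-- The matrix coefficient `u ↦ u_{ij}` of the two-dimensional module `V_1`. -/
def stdCoeff (i j : Fin 2) : UqDual q :=
  matrixCoeff (irrep q 1) (LinearMap.proj i) (Pi.single j 1)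

/-- The action of `U_q(𝔰𝔩₂)` on `V_1 ⊗ V_1`. -/
def stdTensor : Uq q →ₐ[ℂ] Module.End ℂ ((Fin 2 → ℂ) ⊗[ℂ] (Fin 2 → ℂ)) :=
  (Module.endTensorEndAlgHom (R := ℂ) (S := ℂ) (A := ℂ)).comp
    ((Algebra.TensorProduct.map (irrep q 1) (irrep q 1)).comp (Uq.comul q))

theorem Uq.induction {p : Uq q → Prop} (h₀ : ∀ r, p (algebraMap ℂ (Uq q) r))
    (h₁ : ∀ g, p (Uq.gen q g)) (h₂ : ∀ x y, p x → p y → p (x * y))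
    (h₃ : ∀ x y, p x → p y → p (x + y)) (u : Uq q) : p u := by
  obtain ⟨u, rfl⟩ := Presented.mk_surjective u
  induction u using FreeAlgebra.induction with
  | grade0 r => simpa using h₀ r
  | grade1 g => exact h₁ g
  | mul x y hx hy => simpa using h₂ _ _ hx hy
  | add x y hx hy => simpa using h₃ _ _ hx hy

theorem stdCoeff_mul_apply (i j k l : Fin 2) (u : Uq q) :
    (stdCoeff q i j * stdCoeff q k l) u =
      LinearMap.mul' ℂ ℂ (TensorProduct.map (LinearMap.proj i) (LinearMap.proj k)
        (stdTensor q u (Pi.single j 1 ⊗ₜ Pi.single l 1))) := by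
  rw [LinearMap.convMul_apply]
  change _ = LinearMap.mul' ℂ ℂ (TensorProduct.map (LinearMap.proj i) (LinearMap.proj k)
    (Module.endTensorEndAlgHom (R := ℂ) (S := ℂ) (A := ℂ)
      (Algebra.TensorProduct.map (irrep q 1) (irrep q 1) (Coalgebra.comul (R := ℂ) u)) _))
  generalize Coalgebra.comul (R := ℂ) u = t
  induction t with
  | zero => simp
  | add x y hx hy => simp only [map_add, hx, hy, LinearMap.add_apply]
  | tmul x y => simp [stdCoeff, matrixCoeff, Module.endTensorEndAlgHom_apply]

theorem irrep_one_gen_apply (g : UqGen) (j : Fin 2) :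
    irrep q 1 (Uq.gen q g) (Pi.single j 1) = fun i => irrepGen q 1 g i j := by
  simp only [irrep, irrepMatrix, AlgHom.comp_apply, Uq.lift_gen]
  exact Matrix.mulVec_single_one (irrepGen q 1 g) j

theorem irrep_one_E (j : Fin 2) : irrep q 1 (Uq.gen q .E) (Pi.single j 1) =
    if j = 0 then 0 else qInt q 1 • Pi.single 0 1 := by
  rw [irrep_one_gen_apply]
  ext i
  fin_cases i <;> fin_cases j <;> simp [irrepGen]

theorem irrep_one_F (j : Fin 2) : irrep q 1 (Uq.gen q .F) (Pi.single j 1) =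
    if j = 0 then qInt q 1 • Pi.single 1 1 else 0 := by
  rw [irrep_one_gen_apply]
  ext i
  fin_cases i <;> fin_cases j <;> simp [irrepGen]

theorem irrep_one_K (j : Fin 2) : irrep q 1 (Uq.gen q .K) (Pi.single j 1) =
    (if j = 0 then (q : ℂ) else (q : ℂ)⁻¹) • Pi.single j 1 := by
  rw [irrep_one_gen_apply]
  ext i
  fin_cases i <;> fin_cases j <;> norm_num [irrepGen]

theorem irrep_one_Kinv (j : Fin 2) : irrep q 1 (Uq.gen q .Kinv) (Pi.single j 1) =
    (if j = 0 then (q : ℂ)⁻¹ else (q : ℂ)) • Pi.single j 1 := by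
  rw [irrep_one_gen_apply]
  ext i
  fin_cases i <;> fin_cases j <;> norm_num [irrepGen]

/-- The tensor `v_i ⊗ v_j` of basis vectors of `V_1`. -/
def stdBasis (i j : Fin 2) : (Fin 2 → ℂ) ⊗[ℂ] (Fin 2 → ℂ) := Pi.single i 1 ⊗ₜ Pi.single j 1

theorem stdTensor_gen (g : UqGen) (i j : Fin 2) : stdTensor q (Uq.gen q g) (stdBasis i j) =
    (match g with
    | .E => (if i = 0 then 0 else qInt q 1 • stdBasis 0 j) +
        (if j = 0 then 0 else ((if i = 0 then (q : ℂ) else (q : ℂ)⁻¹) * qInt q 1) • stdBasis i 0)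
    | .F => (if i = 0 then (qInt q 1 * (if j = 0 then (q : ℂ)⁻¹ else (q : ℂ))) • stdBasis 1 j
          else 0) + (if j = 0 then qInt q 1 • stdBasis i 1 else 0)
    | .K => ((if i = 0 then (q : ℂ) else (q : ℂ)⁻¹) * (if j = 0 then (q : ℂ) else (q : ℂ)⁻¹)) •
        stdBasis i j
    | .Kinv => ((if i = 0 then (q : ℂ)⁻¹ else (q : ℂ)) * (if j = 0 then (q : ℂ)⁻¹ else (q : ℂ))) •
        stdBasis i j : (Fin 2 → ℂ) ⊗[ℂ] (Fin 2 → ℂ)) := by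
  cases g <;> fin_cases i <;> fin_cases j <;>
    simp [stdTensor, Uq.comul, Uq.comulGen, stdBasis, irrep_one_E, irrep_one_F,
      irrep_one_K, irrep_one_Kinv, TensorProduct.smul_tmul', TensorProduct.tmul_smul,
      Module.endTensorEndAlgHom_apply, smul_smul, mul_comm (qInt q 1)]

theorem stdTensor_invariant (u : Uq q) :
    stdTensor q u (stdBasis 0 1 - (q : ℂ) • stdBasis 1 0) =
      Uq.counit q u • (stdBasis 0 1 - (q : ℂ) • stdBasis 1 0) := by
  have hq : (q : ℂ) ≠ 0 := q.ne_zero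
  induction u using Uq.induction with
  | h₀ r => simp [Algebra.algebraMap_eq_smul_one]
  | h₁ g => 
    cases g <;> simp [stdTensor_gen, Uq.counit, smul_smul, hq, mul_comm (qInt q 1)]
  | h₂ x y hx hy => 
    rw [map_mul, Module.End.mul_apply, hy, map_smul, hx, smul_smul, map_mul, mul_comm]
  | h₃ x y hx hy => rw [map_add, LinearMap.add_apply, hx, hy, map_add, add_smul]

/-- The coordinate of `v_i ⊗ v_k` on `V_1 ⊗ V_1`. -/
def stdCoord (i k : Fin 2) : Module.Dual ℂ ((Fin 2 → ℂ) ⊗[ℂ] (Fin 2 → ℂ)) :=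
  LinearMap.mul' ℂ ℂ ∘ₗ TensorProduct.map (LinearMap.proj i) (LinearMap.proj k)

theorem stdCoord_stdBasis (i j k l : Fin 2) :
    stdCoord i k (stdBasis j l) = if i = j ∧ k = l then 1 else 0 := by
  by_cases h : i = j <;> by_cases h' : k = l <;> 
    simp [stdCoord, stdBasis, h, h']

theorem stdTensor_coinvariant (u : Uq q) (t : (Fin 2 → ℂ) ⊗[ℂ] (Fin 2 → ℂ)) :
    (stdCoord 0 1 - (q : ℂ) • stdCoord 1 0) (stdTensor q u t) =
      Uq.counit q u * (stdCoord 0 1 - (q : ℂ) • stdCoord 1 0) t := by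
  have hq : (q : ℂ) ≠ 0 := q.ne_zero
  induction u using Uq.induction generalizing t with
  | h₀ r => simp [Algebra.algebraMap_eq_smul_one]
  | h₁ g =>
    suffices h : (stdCoord 0 1 - (q : ℂ) • stdCoord 1 0) ∘ₗ stdTensor q (Uq.gen q g) =
        Uq.counit q (Uq.gen q g) • (stdCoord 0 1 - (q : ℂ) • stdCoord 1 0) from
      LinearMap.congr_fun h t
    refine ((Pi.basisFun ℂ (Fin 2)).tensorProduct (Pi.basisFun ℂ (Fin 2))).ext fun ⟨i, j⟩ => ?_
    rw [Module.Basis.tensorProduct_apply, Pi.basisFun_apply, Pi.basisFun_apply]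
    change ((stdCoord 0 1 - (q : ℂ) • stdCoord 1 0) ∘ₗ stdTensor q (Uq.gen q g)) (stdBasis i j) =
      (Uq.counit q (Uq.gen q g) • (stdCoord 0 1 - (q : ℂ) • stdCoord 1 0)) (stdBasis i j)
    rw [LinearMap.comp_apply, stdTensor_gen]
    cases g <;> fin_cases i <;> fin_cases j <;>
      simp [stdCoord_stdBasis, Uq.counit, hq, mul_comm (qInt q 1)]
  | h₂ x y hx hy => rw [map_mul, Module.End.mul_apply, hx, hy, map_mul, mul_assoc]
  | h₃ x y hx hy => rw [map_add, LinearMap.add_apply, map_add, hx, hy, map_add, add_mul]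

theorem stdCoeff_mul_apply' (i j k l : Fin 2) (u : Uq q) :
    (stdCoeff q i j * stdCoeff q k l) u = stdCoord i k (stdTensor q u (stdBasis j l)) :=
  stdCoeff_mul_apply q i j k l u

theorem stdCoeff_row (i k : Fin 2) :
    stdCoeff q i 0 * stdCoeff q k 1 - (q : ℂ) • (stdCoeff q i 1 * stdCoeff q k 0) =
      algebraMap ℂ (UqDual q) (stdCoord i k (stdBasis 0 1 - (q : ℂ) • stdBasis 1 0)) := by
  ext u
  have h := congrArg (stdCoord i k) (stdTensor_invariant q u)
  rw [map_sub, map_smul, map_sub, map_smul, map_smul, ← stdCoeff_mul_apply',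
    ← stdCoeff_mul_apply'] at h
  refine h.trans ?_
  rw [smul_eq_mul, mul_comm]
  rfl

theorem stdCoeff_col (j l : Fin 2) :
    stdCoeff q 0 j * stdCoeff q 1 l - (q : ℂ) • (stdCoeff q 1 j * stdCoeff q 0 l) =
      algebraMap ℂ (UqDual q) ((stdCoord 0 1 - (q : ℂ) • stdCoord 1 0) (stdBasis j l)) := by
  ext u
  have h := stdTensor_coinvariant q u (stdBasis j l)
  rw [LinearMap.sub_apply, LinearMap.smul_apply, ← stdCoeff_mul_apply',
    ← stdCoeff_mul_apply'] at h
  refine h.trans ?_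
  rw [mul_comm]
  rfl

/-- The assignment of `a`, `b`, `c`, `d` to the matrix coefficients of `V_1`. -/
def genCoeff : MatGen → UqDual q
  | .a => stdCoeff q 0 0
  | .b => stdCoeff q 0 1
  | .c => stdCoeff q 1 0
  | .d => stdCoeff q 1 1

theorem genCoeff_rel :
    genCoeff q .a * genCoeff q .b = (q : ℂ) • (genCoeff q .b * genCoeff q .a) ∧
    genCoeff q .a * genCoeff q .c = (q : ℂ) • (genCoeff q .c * genCoeff q .a) ∧
    genCoeff q .b * genCoeff q .c = genCoeff q .c * genCoeff q .b ∧
    genCoeff q .b * genCoeff q .d = (q : ℂ) • (genCoeff q .d * genCoeff q .b) ∧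
    genCoeff q .c * genCoeff q .d = (q : ℂ) • (genCoeff q .d * genCoeff q .c) ∧
    genCoeff q .a * genCoeff q .d - genCoeff q .d * genCoeff q .a =
      ((q : ℂ) - (q : ℂ)⁻¹) • (genCoeff q .b * genCoeff q .c) ∧
    genCoeff q .a * genCoeff q .d - (q : ℂ) • (genCoeff q .b * genCoeff q .c) = 1 := by
  have hq : (q : ℂ) ≠ 0 := q.ne_zero
  have r00 := stdCoeff_row q 0 0
  have r01 := stdCoeff_row q 0 1
  have r10 := stdCoeff_row q 1 0
  have r11 := stdCoeff_row q 1 1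
  have c00 := stdCoeff_col q 0 0
  have c10 := stdCoeff_col q 1 0
  have c11 := stdCoeff_col q 1 1
  simp only [map_sub, map_smul, stdCoord_stdBasis, LinearMap.sub_apply, LinearMap.smul_apply,
    smul_eq_mul] at r00 r01 r10 r11 c00 c10 c11
  norm_num at r00 r01 r10 r11 c00 c10 c11
  simp only [genCoeff]
  have hbc : stdCoeff q 0 1 * stdCoeff q 1 0 = stdCoeff q 1 0 * stdCoeff q 0 1 :=
    sub_left_injective (c10.trans r10.symm)
  have hda : stdCoeff q 1 1 * stdCoeff q 0 0 =
      1 + (q : ℂ)⁻¹ • (stdCoeff q 0 1 * stdCoeff q 1 0) := by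
    have h := congrArg ((q : ℂ)⁻¹ • ·) c10
    simp only [smul_sub, smul_smul, inv_mul_cancel₀ hq, one_smul, smul_neg] at h
    rw [Algebra.algebraMap_eq_smul_one, smul_smul, inv_mul_cancel₀ hq, one_smul] at h
    rw [sub_eq_iff_eq_add] at h
    rw [h]
    abel
  refine ⟨sub_eq_zero.1 r00, sub_eq_zero.1 c00, hbc, sub_eq_zero.1 c11, sub_eq_zero.1 r11, ?_,
    r01⟩
  rw [hda, sub_eq_iff_eq_add.1 r01, sub_smul]
  abel

/-- The morphism from `O_q(SL₂)` to the dual of `U_q(𝔰𝔩₂)` that sends the matrix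
`(a, b; c, d)` to the matrix coefficients of `V_1`. -/
def toUqDual : OqSL2 q →ₐ[ℂ] UqDual q :=
  Presented.lift
    (Presented.lift (FreeAlgebra.lift ℂ (genCoeff q)) (by
      obtain ⟨h₁, h₂, h₃, h₄, h₅, h₆, -⟩ := genCoeff_rel q
      rintro _ _ (_ | _ | _ | _ | _ | _) <;> simpa))
    (by
      rintro _ _ ⟨⟩
      obtain ⟨-, -, -, -, -, -, h⟩ := genCoeff_rel q
      simpa [qDet, OqMat.gen] using h)

theorem toUqDual_gen (g : MatGen) : toUqDual q (OqFibre.gen q 1 g) = genCoeff q g := by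
  simp [toUqDual, OqFibre.gen, OqMat.gen]

end PeterWeyl

section Filtration

/-- The weight lattice `ℤ` of `SL₂`, with the dominance order: `m ≤ n` if and only if `n - m` is a
nonnegative multiple of the simple root `2`. -/
def Weight : Type := ℤ

instance : CommRing Weight := inferInstanceAs (CommRing ℤ)

instance : DecidableEq Weight := inferInstanceAs (DecidableEq ℤ)

instance : PartialOrder Weight where
  le m n := ∃ r : ℕ, n = m + 2 * r
  le_refl m := ⟨0, by simp⟩
  le_trans l m n := by
    rintro ⟨r, rfl⟩ ⟨s, rfl⟩
    exact ⟨r + s, by push_cast; ring⟩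
  le_antisymm m n := by
    rintro ⟨r, hr⟩ ⟨s, hs⟩
    have hr' : @Eq ℤ n (@HAdd.hAdd ℤ ℤ ℤ _ m (2 * (r : ℤ))) := hr
    have hs' : @Eq ℤ m (@HAdd.hAdd ℤ ℤ ℤ _ n (2 * (s : ℤ))) := hs
    have h : @Eq ℤ m n := by omega
    exact h

instance : IsOrderedCancelAddMonoid Weight where
  add_le_add_left m n := by
    rintro ⟨r, rfl⟩ l
    exact ⟨r, by ring⟩
  le_of_add_le_add_left l m n := by
    rintro ⟨r, hr⟩
    exact ⟨r, add_left_cancel (hr.trans (add_assoc _ _ _))⟩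

variable (q : ℂˣ)

/-- The span, in the dual of `U_q(𝔰𝔩₂)`, of the matrix coefficients of the modules `V_m` with
`m ≤ n`. -/
def coeffSpan (n : Weight) : Submodule ℂ (UqDual q) :=
  Submodule.span ℂ
    {φ | ∃ m : ℕ, (m : Weight) ≤ n ∧ ∃ f v, φ = matrixCoeff (irrep q m) f v}

/-- The Peter–Weyl filtration: `O_q(SL₂)_{≤ n}` consists of the elements of `O_q(SL₂)` whose image
in the dual of `U_q(𝔰𝔩₂)` is a sum of matrix coefficients of modules `V_m` with `m ≤ n`. When
`O_q(SL₂)` is identified with the algebra of matrix coefficients through `toUqDual`, this is the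
image of the sum of the `V_m ⊗ V_m^*` with `m ≤ n`. -/
def peterWeyl (n : Weight) : Submodule ℂ (OqSL2 q) :=
  (coeffSpan q n).comap (toUqDual q).toLinearMap

theorem gen_mem_peterWeyl (g : MatGen) : OqFibre.gen q 1 g ∈ peterWeyl q 1 := by
  change toUqDual q (OqFibre.gen q 1 g) ∈ coeffSpan q 1
  rw [toUqDual_gen]
  refine Submodule.subset_span ⟨1, by simp, ?_⟩
  cases g <;> exact ⟨_, _, rfl⟩

end Filtration

section QuantumPlane

/-- The defining relation of the quantum plane, in the free algebra on `x = ι 0` and `y = ι 1`. -/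
inductive PlaneRel (q : ℂˣ) : FreeAlgebra ℂ (Fin 2) → FreeAlgebra ℂ (Fin 2) → Prop
  | x_y : PlaneRel q (FreeAlgebra.ι ℂ 0 * FreeAlgebra.ι ℂ 1)
      ((q : ℂ) • (FreeAlgebra.ι ℂ 1 * FreeAlgebra.ι ℂ 0))

variable (q : ℂˣ)

/-- The quantum plane `ℂ⟨x, y⟩ / ⟨xy - qyx⟩`. -/
abbrev Plane : Type := Presented (PlaneRel q)

/-- The generators `x` (index `0`) and `y` (index `1`) of the quantum plane. -/
def Plane.gen (i : Fin 2) : Plane q := Presented.mk (PlaneRel q) (FreeAlgebra.ι ℂ i)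

/-- `Sym_q^k(ℂ²)`, the component of degree `k` of the quantum plane: the span of the products of `k`
generators. -/
def symq (k : ℕ) : Submodule ℂ (Plane q) := Submodule.span ℂ (Set.range (Plane.gen q)) ^ k

instance : SetLike.GradedMonoid (symq q) :=
  Submodule.nat_power_gradedMonoid (Submodule.span ℂ (Set.range (Plane.gen q)))

/-- `Sym_q^k(ℂ²) ⊗ Sym_q^k(ℂ²)`, as a subspace of the tensor product of two quantum planes. -/
def segrePiece (k : ℕ) : Submodule ℂ (Plane q ⊗[ℂ] Plane q) :=
  LinearMap.range (TensorProduct.map (symq q k).subtype (symq q k).subtype)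

instance : SetLike.GradedMonoid (segrePiece q) where
  one_mem := ⟨⟨1, SetLike.one_mem_graded (symq q)⟩ ⊗ₜ ⟨1, SetLike.one_mem_graded (symq q)⟩, rfl⟩
  mul_mem := by
    rintro i j _ _ ⟨s, rfl⟩ ⟨t, rfl⟩
    induction s with
    | zero => simp
    | add s₁ s₂ h₁ h₂ => rw [map_add, add_mul]; exact add_mem h₁ h₂
    | tmul x y =>
      induction t with
      | zero => simp
      | add t₁ t₂ h₁ h₂ => rw [map_add, mul_add]; exact add_mem h₁ h₂
      | tmul z w =>
        exact ⟨⟨_, SetLike.mul_mem_graded x.2 z.2⟩ ⊗ₜ ⟨_, SetLike.mul_mem_graded y.2 w.2⟩, by simp⟩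

/-- The algebra `⨁_k Sym_q^k(ℂ²) ⊗ Sym_q^k(ℂ²)`, called `ℙ¹_q × ℙ¹_q`. -/
abbrev SegreAlg : Type := ⨁ k, segrePiece q k

/-- The component `Sym_q^k(ℂ²) ⊗ Sym_q^k(ℂ²)` of degree `k`. -/
def SegreAlg.component (k : ℕ) : Submodule ℂ (SegreAlg q) :=
  LinearMap.range (DirectSum.lof ℂ ℕ (fun k => segrePiece q k) k)

theorem gen_tmul_gen_mem (i j : Fin 2) : Plane.gen q i ⊗ₜ Plane.gen q j ∈ segrePiece q 1 := by
  have h : ∀ i, Plane.gen q i ∈ symq q 1 := fun i => by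
    rw [symq, pow_one]
    exact Submodule.subset_span ⟨i, rfl⟩
  exact ⟨⟨_, h i⟩ ⊗ₜ ⟨_, h j⟩, rfl⟩

/-- The element of degree one given by the tensor product of the `i`-th coordinate of the first
quantum plane and the `j`-th coordinate of the second. -/
def SegreAlg.gen (i j : Fin 2) : SegreAlg q :=
  DirectSum.of (fun k => segrePiece q k) 1 ⟨Plane.gen q i ⊗ₜ Plane.gen q j, gen_tmul_gen_mem q i j⟩

end QuantumPlane

end QuantumSL2

end

/-!
Clebsch–Gordan, `V_{n+1} ⊗ V_1 ≅ V_{n+2} ⊕ V_n`, together with the determinant relation identifies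
the span of the matrix coefficients of the `V_m`, `m ≤ n`, with the `n`-th power of the span of
`a, b, c, d`. Hence the associated graded algebra is generated by the symbols of `a, b, c, d`, and
these satisfy `ad = qbc`, because `1` has degree `0 < 2`. So `O_q(Mat₂) / ⟨ad - qbc⟩` maps onto
it, and likewise onto the Segre algebra. Normal monomials bound the dimension of the degree `n` part
of `O_q(Mat₂) / ⟨ad - qbc⟩` by `(n + 1)²`. Both targets attain this bound: the matrix coefficients
of the various `V_n` are linearly independent, being separated by the Casimir element and by the
action of `K` on the two sides, and the monomials `y^j x^i` are linearly independent in the quantum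
plane. So both surjections are isomorphisms.
-/

noncomputable section

namespace QuantumSL2

section QuantumIntegers

variable {q : ℂˣ}

theorem zpow_val_injective (hq : ¬ IsOfFinOrder q) :
    Function.Injective fun n : ℤ => (q : ℂ) ^ n := by
  intro m n h
  refine injective_zpow_iff_not_isOfFinOrder.2 hq (Units.ext ?_)
  simpa using h

theorem sub_inv_ne_zero (hq : ¬ IsOfFinOrder q) : (q : ℂ) - (q : ℂ)⁻¹ ≠ 0 := by
  intro h
  have h' : (1 : ℤ) = -1 := zpow_val_injective hq (by simpa using sub_eq_zero.1 h)
  omega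

theorem qInt_mul_sub_inv (hq : ¬ IsOfFinOrder q) (n : ℤ) :
    qInt q n * ((q : ℂ) - (q : ℂ)⁻¹) = (q : ℂ) ^ n - (q : ℂ) ^ (-n) :=
  div_mul_cancel₀ _ (sub_inv_ne_zero hq)

theorem qInt_one (hq : ¬ IsOfFinOrder q) : qInt q 1 = 1 := by
  simp [qInt, div_self (sub_inv_ne_zero hq)]

theorem qInt_ne_zero (hq : ¬ IsOfFinOrder q) {n : ℤ} (hn : n ≠ 0) : qInt q n ≠ 0 := by
  refine div_ne_zero (fun h => hn ?_) (sub_inv_ne_zero hq)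
  have : n = -n := zpow_val_injective hq (sub_eq_zero.1 h)
  omega

theorem qInt_add (a b : ℤ) :
    qInt q (a + b) = ((q : ℂ) ^ b)⁻¹ * qInt q a + (q : ℂ) ^ a * qInt q b := by
  have hq0 : (q : ℂ) ≠ 0 := q.ne_zero
  simp only [qInt, neg_add, zpow_add₀ hq0, zpow_neg]
  ring

end QuantumIntegers

section Representations

variable {q : ℂˣ} {M N L : Type*} [AddCommGroup M] [Module ℂ M] [AddCommGroup N] [Module ℂ N]
  [AddCommGroup L] [Module ℂ L]

/-- The matrix coefficient `c_{f,v}` as a bilinear function of `f` and `v`. -/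
def matrixCoeffHom (ρ : Uq q →ₐ[ℂ] Module.End ℂ M) : Module.Dual ℂ M →ₗ[ℂ] M →ₗ[ℂ] UqDual q :=
  LinearMap.mk₂ ℂ (matrixCoeff ρ) (fun _ _ _ => rfl) (fun _ _ _ => rfl)
    (fun f v w => by ext u; simp [matrixCoeff]) (fun r f v => by ext u; simp [matrixCoeff])

/-- The span of the matrix coefficients of a representation. -/
def coeffSpace (ρ : Uq q →ₐ[ℂ] Module.End ℂ M) : Submodule ℂ (UqDual q) :=
  Submodule.map₂ (matrixCoeffHom ρ) ⊤ ⊤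

theorem matrixCoeff_mem_coeffSpace (ρ : Uq q →ₐ[ℂ] Module.End ℂ M) (f : Module.Dual ℂ M) (v : M) :
    matrixCoeff ρ f v ∈ coeffSpace ρ :=
  Submodule.apply_mem_map₂ (matrixCoeffHom ρ) trivial trivial

theorem coeffSpace_le_iff {ρ : Uq q →ₐ[ℂ] Module.End ℂ M} {P : Submodule ℂ (UqDual q)} :
    coeffSpace ρ ≤ P ↔ ∀ f v, matrixCoeff ρ f v ∈ P :=
  Submodule.map₂_le.trans ⟨fun h f v => h f trivial v trivial, fun h f _ v _ => h f v⟩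

theorem coeffSpace_eq_span (ρ : Uq q →ₐ[ℂ] Module.End ℂ M) {s : Set (Module.Dual ℂ M)} {t : Set M}
    (hs : Submodule.span ℂ s = ⊤) (ht : Submodule.span ℂ t = ⊤) :
    coeffSpace ρ = Submodule.span ℂ (Set.image2 (matrixCoeff ρ) s t) := by
  rw [coeffSpace, ← hs, ← ht, Submodule.map₂_span_span]
  rfl

/-- The tensor product of two representations of `U_q(𝔰𝔩₂)`. -/
def tensorRep (ρ : Uq q →ₐ[ℂ] Module.End ℂ M) (σ : Uq q →ₐ[ℂ] Module.End ℂ N) :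
    Uq q →ₐ[ℂ] Module.End ℂ (M ⊗[ℂ] N) :=
  (Module.endTensorEndAlgHom (R := ℂ) (S := ℂ) (A := ℂ)).comp
    ((Algebra.TensorProduct.map ρ σ).comp (Uq.comul q))

section

variable (ρ : Uq q →ₐ[ℂ] Module.End ℂ M) (σ : Uq q →ₐ[ℂ] Module.End ℂ N) (v : M) (w : N)

theorem tensorRep_E : tensorRep ρ σ (Uq.gen q .E) (v ⊗ₜ w) =
    ρ (Uq.gen q .E) v ⊗ₜ w + ρ (Uq.gen q .K) v ⊗ₜ σ (Uq.gen q .E) w := by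
  simp [tensorRep, Uq.comul, Uq.comulGen, Module.endTensorEndAlgHom_apply]

theorem tensorRep_F : tensorRep ρ σ (Uq.gen q .F) (v ⊗ₜ w) =
    ρ (Uq.gen q .F) v ⊗ₜ σ (Uq.gen q .Kinv) w + v ⊗ₜ σ (Uq.gen q .F) w := by
  simp [tensorRep, Uq.comul, Uq.comulGen, Module.endTensorEndAlgHom_apply]

theorem tensorRep_K : tensorRep ρ σ (Uq.gen q .K) (v ⊗ₜ w) =
    ρ (Uq.gen q .K) v ⊗ₜ σ (Uq.gen q .K) w := by
  simp [tensorRep, Uq.comul, Uq.comulGen, Module.endTensorEndAlgHom_apply]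

theorem matrixCoeff_mul (f : Module.Dual ℂ M) (g : Module.Dual ℂ N) :
    matrixCoeff ρ f v * matrixCoeff σ g w =
      matrixCoeff (tensorRep ρ σ) (TensorProduct.dualDistrib ℂ M N (f ⊗ₜ g)) (v ⊗ₜ w) := by
  ext u
  rw [LinearMap.convMul_apply]
  change _ = TensorProduct.dualDistrib ℂ M N (f ⊗ₜ g)
    (Module.endTensorEndAlgHom (R := ℂ) (S := ℂ) (A := ℂ)
      (Algebra.TensorProduct.map ρ σ (Coalgebra.comul (R := ℂ) u)) _)
  generalize Coalgebra.comul (R := ℂ) u = t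
  induction t with
  | zero => simp
  | add x y hx hy => simp only [map_add, hx, hy, LinearMap.add_apply]
  | tmul x y => simp [matrixCoeff, Module.endTensorEndAlgHom_apply]

end

theorem coeffSpace_tensorRep [Module.Finite ℂ M] [Module.Finite ℂ N]
    (ρ : Uq q →ₐ[ℂ] Module.End ℂ M) (σ : Uq q →ₐ[ℂ] Module.End ℂ N) :
    coeffSpace (tensorRep ρ σ) = coeffSpace ρ * coeffSpace σ := by
  have hdual : Submodule.span ℂ (TensorProduct.dualDistrib ℂ M N '' {t | ∃ f g, f ⊗ₜ g = t}) =
      ⊤ := by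
    rw [← Submodule.map_span, TensorProduct.span_tmul_eq_top, Submodule.map_top,
      LinearMap.range_eq_top]
    exact (TensorProduct.dualDistribEquiv ℂ M N).surjective
  rw [coeffSpace_eq_span _ hdual (TensorProduct.span_tmul_eq_top ℂ M N),
    coeffSpace_eq_span ρ Submodule.span_univ Submodule.span_univ,
    coeffSpace_eq_span σ Submodule.span_univ Submodule.span_univ, Submodule.span_mul_span]
  congr 1
  ext φ
  constructor
  · rintro ⟨_, ⟨_, ⟨f, g, rfl⟩, rfl⟩, _, ⟨v, w, rfl⟩, rfl⟩
    exact ⟨_, ⟨f, trivial, v, trivial, rfl⟩, _, ⟨g, trivial, w, trivial, rfl⟩,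
      matrixCoeff_mul ρ σ v w f g⟩
  · rintro ⟨_, ⟨f, -, v, -, rfl⟩, _, ⟨g, -, w, -, rfl⟩, rfl⟩
    exact ⟨_, ⟨_, ⟨f, g, rfl⟩, rfl⟩, _, ⟨v, w, rfl⟩, (matrixCoeff_mul ρ σ v w f g).symm⟩

/-- The property of a linear map to commute with the action of `U_q(𝔰𝔩₂)`. -/
def IsIntertwiner (ρ : Uq q →ₐ[ℂ] Module.End ℂ M) (σ : Uq q →ₐ[ℂ] Module.End ℂ N)
    (T : M →ₗ[ℂ] N) : Prop :=
  ∀ u v, T (ρ u v) = σ u (T v)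

namespace IsIntertwiner

variable {ρ : Uq q →ₐ[ℂ] Module.End ℂ M} {σ : Uq q →ₐ[ℂ] Module.End ℂ N}
  {τ : Uq q →ₐ[ℂ] Module.End ℂ L}

theorem of_gen {T : M →ₗ[ℂ] N} (h : ∀ g, T ∘ₗ ρ (Uq.gen q g) = σ (Uq.gen q g) ∘ₗ T) :
    IsIntertwiner ρ σ T := by
  intro u v
  induction u using Uq.induction generalizing v with
  | h₀ r => simp [Algebra.algebraMap_eq_smul_one]
  | h₁ g => exact LinearMap.congr_fun (h g) v
  | h₂ x y hx hy => rw [map_mul, map_mul, Module.End.mul_apply, Module.End.mul_apply, hx, hy]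
  | h₃ x y hx hy =>
    rw [map_add, map_add, LinearMap.add_apply, LinearMap.add_apply, map_add, hx, hy]

theorem matrixCoeff_apply {T : M →ₗ[ℂ] N} (h : IsIntertwiner ρ σ T) (f : Module.Dual ℂ N) (v : M) :
    matrixCoeff σ f (T v) = matrixCoeff ρ (f ∘ₗ T) v := by
  ext u
  exact congrArg f (h u v).symm

theorem coeffSpace_le {T : M →ₗ[ℂ] N} (h : IsIntertwiner ρ σ T) (hT : Function.Injective T) :
    coeffSpace ρ ≤ coeffSpace σ := by
  refine coeffSpace_le_iff.2 fun f v => ?_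
  obtain ⟨f, rfl⟩ := T.dualMap_surjective_of_injective hT f
  exact h.matrixCoeff_apply f v ▸ matrixCoeff_mem_coeffSpace σ f (T v)

theorem coeffSpace_le_sup {S : M →ₗ[ℂ] L} {T : N →ₗ[ℂ] L} (hS : IsIntertwiner ρ τ S)
    (hT : IsIntertwiner σ τ T) (h : Function.Surjective (S.coprod T)) :
    coeffSpace τ ≤ coeffSpace ρ ⊔ coeffSpace σ := by
  refine coeffSpace_le_iff.2 fun f v => ?_
  obtain ⟨⟨x, y⟩, rfl⟩ := h v
  have hadd : matrixCoeff τ f (S x + T y) = matrixCoeff τ f (S x) + matrixCoeff τ f (T y) :=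
    map_add (matrixCoeffHom τ f) _ _
  rw [LinearMap.coprod_apply, hadd, hS.matrixCoeff_apply, hT.matrixCoeff_apply]
  exact Submodule.add_mem_sup (matrixCoeff_mem_coeffSpace _ _ _) (matrixCoeff_mem_coeffSpace _ _ _)

end IsIntertwiner

end Representations

section HighestWeight

variable {q : ℂˣ} {M : Type*} [AddCommGroup M] [Module ℂ M]

/-- The basis vector `v_j` of `V_m`, with `v_j = 0` for `j > m`. -/
def irrepVec (m j : ℕ) : Fin (m + 1) → ℂ := fun i => if (i : ℕ) = j then 1 else 0

theorem irrepVec_fin {m : ℕ} (j : Fin (m + 1)) : irrepVec m j = Pi.single j 1 := by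
  ext i
  simp [irrepVec, Pi.single_apply, Fin.ext_iff]

theorem irrepVec_eq_zero {m j : ℕ} (h : m < j) : irrepVec m j = 0 := by
  ext i
  simp [irrepVec, show (i : ℕ) ≠ j by omega]

theorem irrep_gen_apply (m : ℕ) (g : UqGen) (j : Fin (m + 1)) :
    irrep q m (Uq.gen q g) (irrepVec m j) = fun i => irrepGen q m g i j := by
  simp only [irrep, irrepMatrix, AlgHom.comp_apply, Uq.lift_gen, irrepVec_fin]
  exact Matrix.mulVec_single_one (irrepGen q m g) j

theorem irrep_F (m j : ℕ) : irrep q m (Uq.gen q .F) (irrepVec m j) =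
    qInt q (j + 1) • irrepVec m (j + 1) := by
  rcases Nat.lt_or_ge m j with h | h
  · rw [irrepVec_eq_zero h, irrepVec_eq_zero (by omega), map_zero, smul_zero]
  · refine (irrep_gen_apply m .F ⟨j, by omega⟩).trans ?_
    ext i
    simp [irrepGen, irrepVec]

theorem irrep_E_zero (m : ℕ) : irrep q m (Uq.gen q .E) (irrepVec m 0) = 0 := by
  refine (irrep_gen_apply m .E ⟨0, by omega⟩).trans ?_
  ext i
  simp [irrepGen]

theorem irrep_E_succ (m j : ℕ) : irrep q m (Uq.gen q .E) (irrepVec m (j + 1)) =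
    qInt q (m - j) • irrepVec m j := by
  rcases Nat.lt_trichotomy m j with h | rfl | h
  · rw [irrepVec_eq_zero h, irrepVec_eq_zero (by omega), map_zero, smul_zero]
  · rw [irrepVec_eq_zero (by omega), map_zero, sub_self, qInt_zero, zero_smul]
  · refine (irrep_gen_apply m .E ⟨j + 1, by omega⟩).trans ?_
    ext i
    simp [irrepGen, irrepVec, show (m : ℤ) - (j + 1) + 1 = m - j by ring, eq_comm]

theorem irrep_K (m j : ℕ) : irrep q m (Uq.gen q .K) (irrepVec m j) =
    (q : ℂ) ^ ((m : ℤ) - 2 * j) • irrepVec m j := by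
  rcases Nat.lt_or_ge m j with h | h
  · rw [irrepVec_eq_zero h, map_zero, smul_zero]
  · refine (irrep_gen_apply m .K ⟨j, by omega⟩).trans ?_
    ext i
    by_cases hi : (i : ℕ) = j <;> simp [irrepGen, irrepVec, Matrix.diagonal_apply, Fin.ext_iff, hi]

theorem irrep_Kinv (m j : ℕ) : irrep q m (Uq.gen q .Kinv) (irrepVec m j) =
    (q : ℂ) ^ (-((m : ℤ) - 2 * j)) • irrepVec m j := by
  rcases Nat.lt_or_ge m j with h | h
  · rw [irrepVec_eq_zero h, map_zero, smul_zero]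
  · refine (irrep_gen_apply m .Kinv ⟨j, by omega⟩).trans ?_
    ext i
    by_cases hi : (i : ℕ) = j <;> simp [irrepGen, irrepVec, Matrix.diagonal_apply, Fin.ext_iff, hi]

theorem irrep_hom_ext {m : ℕ} {S T : (Fin (m + 1) → ℂ) →ₗ[ℂ] M}
    (h : ∀ j, S (irrepVec m j) = T (irrepVec m j)) : S = T := by
  refine (Pi.basisFun ℂ (Fin (m + 1))).ext fun j => ?_
  rw [Pi.basisFun_apply, ← irrepVec_fin]
  exact h j

theorem irrep_zero_apply (u : Uq q) (v : Fin 1 → ℂ) : irrep q 0 u v = Uq.counit q u • v := by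
  suffices h : irrep q 0 = (Algebra.ofId ℂ (Module.End ℂ (Fin 1 → ℂ))).comp (Uq.counit q) by
    rw [h]
    exact Module.algebraMap_end_apply ℂ ℂ _ _ _
  refine Uq.algHom_ext fun g => irrep_hom_ext fun j => ?_
  rcases j with _ | j
  · cases g <;> simp [irrep_E_zero, irrep_F, irrep_K, irrep_Kinv, irrepVec_eq_zero, Uq.counit,
      Algebra.ofId_apply]
  · simp [irrepVec_eq_zero]

/-- The property of `w 0, w 1, …` to be the images of the basis vectors `v_0, …, v_m` of `V_m` under
a homomorphism, obtained from the highest weight vector `w 0` by the divided powers of `F`. -/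
structure IsHighestWeightChain (ρ : Uq q →ₐ[ℂ] Module.End ℂ M) (m : ℕ) (w : ℕ → M) : Prop where
  E_zero : ρ (Uq.gen q .E) (w 0) = 0
  K_zero : ρ (Uq.gen q .K) (w 0) = (q : ℂ) ^ m • w 0
  F_apply (j : ℕ) : ρ (Uq.gen q .F) (w j) = qInt q (j + 1) • w (j + 1)
  eq_zero {j : ℕ} (hj : m < j) : w j = 0

/-- The linear map `V_m → M` sending the basis vector `v_j` to `w j`. -/
def irrepLift (m : ℕ) (w : ℕ → M) : (Fin (m + 1) → ℂ) →ₗ[ℂ] M :=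
  (Pi.basisFun ℂ (Fin (m + 1))).constr ℂ fun j => w j

namespace IsHighestWeightChain

variable {ρ : Uq q →ₐ[ℂ] Module.End ℂ M} {m : ℕ} {w : ℕ → M}

theorem irrepLift_apply (h : IsHighestWeightChain ρ m w) (j : ℕ) :
    irrepLift m w (irrepVec m j) = w j := by
  rcases Nat.lt_or_ge m j with hj | hj
  · rw [irrepVec_eq_zero hj, map_zero, h.eq_zero hj]
  · have := (Pi.basisFun ℂ (Fin (m + 1))).constr_basis ℂ (fun j => w j) ⟨j, by omega⟩
    rwa [Pi.basisFun_apply, ← irrepVec_fin] at this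

theorem K_apply (hq : ¬ IsOfFinOrder q) (h : IsHighestWeightChain ρ m w) (j : ℕ) :
    ρ (Uq.gen q .K) (w j) = (q : ℂ) ^ ((m : ℤ) - 2 * j) • w j := by
  induction j with
  | zero => simpa using h.K_zero
  | succ j ih =>
    have hKF := LinearMap.congr_fun (congrArg ρ (Uq.K_F q)) (w j)
    simp only [map_mul, map_smul, Module.End.mul_apply, LinearMap.smul_apply, ih, h.F_apply,
      smul_smul] at hKF
    refine smul_right_injective M (qInt_ne_zero hq (n := j + 1) (by omega)) ?_
    simp only [hKF, smul_smul]
    congr 1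
    rw [show (m : ℤ) - 2 * (j + 1 : ℕ) = m - 2 * j - 2 by push_cast; ring,
      zpow_sub₀ q.ne_zero (_ - _), zpow_ofNat]
    ring

theorem Kinv_apply (hq : ¬ IsOfFinOrder q) (h : IsHighestWeightChain ρ m w) (j : ℕ) :
    ρ (Uq.gen q .Kinv) (w j) = (q : ℂ) ^ (-((m : ℤ) - 2 * j)) • w j := by
  have hK := LinearMap.congr_fun (congrArg ρ (Uq.Kinv_K q)) (w j)
  simp only [map_mul, map_one, Module.End.mul_apply, Module.End.one_apply, h.K_apply hq,
    map_smul] at hK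
  rw [zpow_neg, eq_inv_smul_iff₀ (zpow_ne_zero _ q.ne_zero)]
  exact hK

theorem E_apply_succ (hq : ¬ IsOfFinOrder q) (h : IsHighestWeightChain ρ m w) (j : ℕ) :
    ρ (Uq.gen q .E) (w (j + 1)) = qInt q (m - j) • w j := by
  have hEF (j : ℕ) : qInt q (j + 1) • ρ (Uq.gen q .E) (w (j + 1)) =
      ρ (Uq.gen q .F) (ρ (Uq.gen q .E) (w j)) + qInt q (m - 2 * j) • w j := by
    have := LinearMap.congr_fun (congrArg ρ (Uq.E_F q)) (w j)
    simp only [map_sub, map_mul, map_smul, Module.End.mul_apply, LinearMap.smul_apply,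
      LinearMap.sub_apply, h.F_apply, h.K_apply hq, h.Kinv_apply hq] at this
    rw [eq_add_of_sub_eq' this, ← sub_smul, smul_smul, qInt, div_eq_inv_mul]
  refine smul_right_injective M (qInt_ne_zero hq (n := j + 1) (by omega)) ?_
  simp only [hEF]
  cases j with
  | zero => simp [h.E_zero, qInt_one hq]
  | succ j =>
    rw [h.E_apply_succ hq j, map_smul, h.F_apply, smul_smul, smul_smul, ← add_smul]
    congr 1
    have := qInt_identity q (j + 1) (m - j - 1)
    rw [← div_eq_inv_mul, ← qInt] at this
    push_cast
    rw [show (m : ℤ) - (j + 1) = m - j - 1 by ring, show (m : ℤ) - 2 * (j + 1) =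
      m - j - 1 - (j + 1) by ring, ← this, show (m : ℤ) - j - 1 + 1 = m - j by ring]
    ring

theorem isIntertwiner (hq : ¬ IsOfFinOrder q) (h : IsHighestWeightChain ρ m w) :
    IsIntertwiner (irrep q m) ρ (irrepLift m w) := by
  refine .of_gen fun g => irrep_hom_ext fun j => ?_
  simp only [LinearMap.comp_apply, h.irrepLift_apply]
  cases g with
  | E =>
    cases j with
    | zero => rw [irrep_E_zero, map_zero, h.E_zero]
    | succ j => rw [irrep_E_succ, map_smul, h.irrepLift_apply, h.E_apply_succ hq]
  | F => rw [irrep_F, map_smul, h.irrepLift_apply, h.F_apply]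
  | K => rw [irrep_K, map_smul, h.irrepLift_apply, h.K_apply hq]
  | Kinv => rw [irrep_Kinv, map_smul, h.irrepLift_apply, h.Kinv_apply hq]

end IsHighestWeightChain

end HighestWeight

section ClebschGordan

variable {q : ℂˣ}

theorem irrep_one_E_vec_one (hq : ¬ IsOfFinOrder q) :
    irrep q 1 (Uq.gen q .E) (irrepVec 1 1) = irrepVec 1 0 := by
  simpa [qInt_one hq] using irrep_E_succ (q := q) 1 0

theorem irrep_one_F_vec_zero (hq : ¬ IsOfFinOrder q) :
    irrep q 1 (Uq.gen q .F) (irrepVec 1 0) = irrepVec 1 1 := by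
  simpa [qInt_one hq] using irrep_F (q := q) 1 0

theorem irrep_one_F_vec_one : irrep q 1 (Uq.gen q .F) (irrepVec 1 1) = 0 := by
  simpa [irrepVec_eq_zero] using irrep_F (q := q) 1 1

theorem irrep_one_K_vec_zero :
    irrep q 1 (Uq.gen q .K) (irrepVec 1 0) = (q : ℂ) • irrepVec 1 0 := by
  simpa using irrep_K (q := q) 1 0

theorem irrep_one_K_vec_one :
    irrep q 1 (Uq.gen q .K) (irrepVec 1 1) = (q : ℂ)⁻¹ • irrepVec 1 1 := by
  simpa [zpow_neg_one] using irrep_K (q := q) 1 1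

theorem irrep_one_Kinv_vec_zero :
    irrep q 1 (Uq.gen q .Kinv) (irrepVec 1 0) = (q : ℂ)⁻¹ • irrepVec 1 0 := by
  simpa using irrep_Kinv (q := q) 1 0

theorem irrep_one_Kinv_vec_one :
    irrep q 1 (Uq.gen q .Kinv) (irrepVec 1 1) = (q : ℂ) • irrepVec 1 1 := by
  simpa using irrep_Kinv (q := q) 1 1

variable (q) in
/-- The basis of the copy of `V_{m+1}` inside `V_m ⊗ V_1`, normalized by `v_0 ↦ v_0 ⊗ v_0`. -/
def cgTopVec (m : ℕ) : ℕ → (Fin (m + 1) → ℂ) ⊗[ℂ] (Fin (1 + 1) → ℂ)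
  | 0 => irrepVec m 0 ⊗ₜ irrepVec 1 0
  | j + 1 => ((q : ℂ) ^ (j + 1))⁻¹ • irrepVec m (j + 1) ⊗ₜ irrepVec 1 0 +
      irrepVec m j ⊗ₜ irrepVec 1 1

variable (q) in
/-- The basis of the copy of `V_m` inside `V_{m+1} ⊗ V_1`. -/
def cgBotVec (m j : ℕ) : (Fin (m + 1 + 1) → ℂ) ⊗[ℂ] (Fin (1 + 1) → ℂ) :=
  ((q : ℂ) ^ ((m : ℤ) + 1 - j) * qInt q (j + 1)) • irrepVec (m + 1) (j + 1) ⊗ₜ irrepVec 1 0 -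
    qInt q (m + 1 - j) • irrepVec (m + 1) j ⊗ₜ irrepVec 1 1

theorem isHighestWeightChain_cgTopVec (hq : ¬ IsOfFinOrder q) (m : ℕ) :
    IsHighestWeightChain (tensorRep (irrep q m) (irrep q 1)) (m + 1) (cgTopVec q m) where
  E_zero := by simp [cgTopVec, tensorRep_E, irrep_E_zero]
  K_zero := by
    simp only [cgTopVec, tensorRep_K, irrep_one_K_vec_zero]
    simp [irrep_K, TensorProduct.smul_tmul', smul_smul, pow_succ']
  F_apply
    | 0 => by
      simp only [cgTopVec, tensorRep_F, irrep_one_Kinv_vec_zero, irrep_one_F_vec_zero hq]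
      simp [irrep_F, qInt_one hq, TensorProduct.smul_tmul']
    | j + 1 => by
      have hadd := qInt_add (q := q) 1 (j + 1)
      simp only [cgTopVec, map_add, map_smul, tensorRep_F, irrep_one_Kinv_vec_zero,
        irrep_one_Kinv_vec_one, irrep_one_F_vec_zero hq, irrep_one_F_vec_one]
      simp only [irrep_F, TensorProduct.tmul_smul, ← TensorProduct.smul_tmul',
        TensorProduct.tmul_zero]
      match_scalars
      · ring
      · rw [show (j : ℤ) + 1 + 1 = 1 + (j + 1) by ring, hadd, qInt_one hq, zpow_one]
        norm_cast
        ring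
  eq_zero {j} hj := by
    obtain ⟨j, rfl⟩ := Nat.exists_eq_add_of_lt hj
    simp [cgTopVec, irrepVec_eq_zero (m := m) (j := m + 1 + j) (by omega),
      irrepVec_eq_zero (m := m) (j := m + 1 + j + 1) (by omega)]

theorem isHighestWeightChain_cgBotVec (hq : ¬ IsOfFinOrder q) (m : ℕ) :
    IsHighestWeightChain (tensorRep (irrep q (m + 1)) (irrep q 1)) m (cgBotVec q m) where
  E_zero := by
    simp only [cgBotVec, map_sub, map_smul, tensorRep_E, irrep_one_E_vec_one hq, irrep_E_zero 1]
    simp only [irrep_E_succ, irrep_E_zero, irrep_K, TensorProduct.tmul_zero,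
      TensorProduct.zero_tmul, ← TensorProduct.smul_tmul']
    match_scalars
    simp [qInt_one hq, mul_comm]
  K_zero := by
    have hq0 : (q : ℂ) ≠ 0 := q.ne_zero
    simp only [cgBotVec, map_sub, map_smul, tensorRep_K, irrep_one_K_vec_zero, irrep_one_K_vec_one]
    simp only [irrep_K, TensorProduct.tmul_smul, ← TensorProduct.smul_tmul']
    match_scalars
    · simp only [zero_add, mul_one, show (m : ℤ) + 1 - 2 = m - 1 by ring, zpow_sub_one₀ hq0,
        zpow_natCast]
      field_simp
    · simp only [mul_zero, sub_zero, mul_one, mul_neg, zpow_add_one₀ hq0, zpow_natCast]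
      field_simp
  F_apply j := by
    have hq0 : (q : ℂ) ≠ 0 := q.ne_zero
    have hadd := qInt_add (q := q) (m - j) 1
    rw [qInt_one hq, zpow_one, mul_one] at hadd
    simp only [cgBotVec, map_sub, map_smul, tensorRep_F, irrep_one_Kinv_vec_zero,
      irrep_one_Kinv_vec_one, irrep_one_F_vec_zero hq, irrep_one_F_vec_one]
    simp only [irrep_F, TensorProduct.tmul_smul, ← TensorProduct.smul_tmul',
      TensorProduct.tmul_zero, Nat.cast_add, Nat.cast_one, add_sub_add_right_eq_sub,
      show (m : ℤ) + 1 - j = m - j + 1 by ring, hadd, zpow_add_one₀ hq0]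
    match_scalars
    · field_simp
    · field_simp
      ring
  eq_zero {j} hj := by
    obtain ⟨j, rfl⟩ := Nat.exists_eq_add_of_lt hj
    cases j with
    | zero => simp [cgBotVec, irrepVec_eq_zero, qInt_zero]
    | succ j => simp [cgBotVec, irrepVec_eq_zero]

theorem eq_top_of_irrepVec_tmul_mem {m : ℕ}
    {R : Submodule ℂ ((Fin (m + 1) → ℂ) ⊗[ℂ] (Fin (1 + 1) → ℂ))}
    (h₀ : ∀ j, irrepVec m j ⊗ₜ irrepVec 1 0 ∈ R) (h₁ : ∀ j, irrepVec m j ⊗ₜ irrepVec 1 1 ∈ R) :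
    R = ⊤ := by
  have hb := ((Pi.basisFun ℂ (Fin (m + 1))).tensorProduct (Pi.basisFun ℂ (Fin (1 + 1)))).span_eq
  rw [eq_top_iff, ← hb, Submodule.span_le]
  rintro _ ⟨⟨i, j⟩, rfl⟩
  rw [Module.Basis.tensorProduct_apply, Pi.basisFun_apply, Pi.basisFun_apply, ← irrepVec_fin,
    ← irrepVec_fin]
  fin_cases j
  · exact h₀ i
  · exact h₁ i

theorem surjective_coprod_clebschGordan (hq : ¬ IsOfFinOrder q) (m : ℕ) :
    Function.Surjective
      ((irrepLift (m + 2) (cgTopVec q (m + 1))).coprod (irrepLift m (cgBotVec q m))) := by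
  rw [← LinearMap.range_eq_top, LinearMap.range_coprod]
  set R := LinearMap.range (irrepLift (m + 2) (cgTopVec q (m + 1))) ⊔
    LinearMap.range (irrepLift m (cgBotVec q m))
  have htop j : cgTopVec q (m + 1) j ∈ R := Submodule.mem_sup_left
    ⟨_, (isHighestWeightChain_cgTopVec hq (m + 1)).irrepLift_apply j⟩
  have hbot j : cgBotVec q m j ∈ R := Submodule.mem_sup_right
    ⟨_, (isHighestWeightChain_cgBotVec hq m).irrepLift_apply j⟩
  have h₀ : ∀ j, irrepVec (m + 1) j ⊗ₜ irrepVec 1 0 ∈ R := by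
    rintro (_ | j)
    · exact htop 0
    · have h := R.add_mem (R.smul_mem (qInt q (m + 1 - j)) (htop (j + 1))) (hbot j)
      have hadd := qInt_add (q := q) (m + 1 - j) (j + 1)
      rw [cgTopVec, cgBotVec, smul_add, add_add_sub_cancel, smul_smul, ← add_smul, mul_comm,
        show (q : ℂ) ^ (j + 1) = (q : ℂ) ^ ((j : ℤ) + 1) by norm_cast, ← hadd] at h
      exact (R.smul_mem_iff (qInt_ne_zero hq (by omega))).1 h
  refine eq_top_of_irrepVec_tmul_mem h₀ fun j => ?_
  exact (R.add_mem_iff_right (R.smul_mem _ (h₀ _))).1 (htop (j + 1))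

theorem injective_irrepLift_cgTopVec (hq : ¬ IsOfFinOrder q) (m : ℕ) :
    Function.Injective (irrepLift (m + 2) (cgTopVec q (m + 1))) := by
  have h : Function.Injective
      ((irrepLift (m + 2) (cgTopVec q (m + 1))).coprod (irrepLift m (cgBotVec q m))) := by
    refine (LinearMap.injective_iff_surjective_of_finrank_eq_finrank ?_).2
      (surjective_coprod_clebschGordan hq m)
    simp only [Module.finrank_prod, Module.finrank_fin_fun, Module.finrank_tensorProduct]
    ring
  intro x y hxy
  exact congrArg Prod.fst (@h (x, 0) (y, 0) (by simpa using hxy))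

theorem coeffSpace_irrep_mul_one_le (hq : ¬ IsOfFinOrder q) (m : ℕ) :
    coeffSpace (irrep q (m + 1)) * coeffSpace (irrep q 1) ≤
      coeffSpace (irrep q (m + 2)) ⊔ coeffSpace (irrep q m) := by
  rw [← coeffSpace_tensorRep]
  exact ((isHighestWeightChain_cgTopVec hq (m + 1)).isIntertwiner hq).coeffSpace_le_sup
    ((isHighestWeightChain_cgBotVec hq m).isIntertwiner hq) (surjective_coprod_clebschGordan hq m)

theorem coeffSpace_irrep_add_two_le (hq : ¬ IsOfFinOrder q) (m : ℕ) :
    coeffSpace (irrep q (m + 2)) ≤ coeffSpace (irrep q (m + 1)) * coeffSpace (irrep q 1) := by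
  rw [← coeffSpace_tensorRep]
  exact ((isHighestWeightChain_cgTopVec hq (m + 1)).isIntertwiner hq).coeffSpace_le
    (injective_irrepLift_cgTopVec hq m)

theorem coeffSpace_irrep_zero : coeffSpace (irrep q 0) = 1 := by
  have h (f : Module.Dual ℂ (Fin 1 → ℂ)) (v : Fin 1 → ℂ) :
      matrixCoeff (irrep q 0) f v = algebraMap ℂ (UqDual q) (f v) := by
    ext u
    rw [LinearMap.convAlgebraMap_apply]
    change f (irrep q 0 u v) = _
    rw [irrep_zero_apply, map_smul, smul_eq_mul, mul_comm]
    rfl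
  refine le_antisymm (coeffSpace_le_iff.2 fun f v => h f v ▸ Submodule.algebraMap_mem _) ?_
  rw [Submodule.one_le]
  simpa [h] using matrixCoeff_mem_coeffSpace (irrep q 0) (LinearMap.proj 0) (Pi.single 0 1)

end ClebschGordan

theorem linearIndependent_of_joint_eigenvectors {k V ι κ : Type*} [Field k] [AddCommGroup V]
    [Module k V] {T : ι → Module.End k V} (hT : ∀ i j, Commute (T i) (T j)) {χ : κ → ι → k}
    (hχ : Function.Injective χ) {v : κ → V} (hv : ∀ x i, T i (v x) = χ x i • v x)
    (hv' : ∀ x, v x ≠ 0) : LinearIndependent k v := by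
  have h : iSupIndep fun χ : ι → k => ⨅ i, (T i).maxGenEigenspace (χ i) :=
    Module.End.independent_iInf_maxGenEigenspace_of_forall_mapsTo T
      fun i j χ => Module.End.mapsTo_maxGenEigenspace_of_comm (hT j i) χ
  have h' : iSupIndep ((fun χ : ι → k => ⨅ i, (T i).maxGenEigenspace (χ i)) ∘ χ) := h.comp hχ
  refine h'.linearIndependent _ (fun x => ?_) hv'
  refine (Submodule.mem_iInf _).2 fun i => Module.End.eigenspace_le_maxGenEigenspace ?_
  exact Module.End.mem_eigenspace_iff.2 (hv x i)

section MatrixCoefficients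

variable {q : ℂˣ}

/-- The element `(q - q⁻¹)² FE + qK + q⁻¹K⁻¹` of `U_q(𝔰𝔩₂)`, which acts on each `V_m` by a
scalar. -/
def casimir (q : ℂˣ) : Uq q :=
  ((q : ℂ) - (q : ℂ)⁻¹) ^ 2 • (Uq.gen q .F * Uq.gen q .E) + (q : ℂ) • Uq.gen q .K +
    (q : ℂ)⁻¹ • Uq.gen q .Kinv

/-- The scalar by which `casimir q` acts on `V_m`. -/
def casimirValue (q : ℂˣ) (m : ℕ) : ℂ := (q : ℂ) ^ (m + 1) + ((q : ℂ) ^ (m + 1))⁻¹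

theorem irrep_casimir (hq : ¬ IsOfFinOrder q) (m : ℕ) (v : Fin (m + 1) → ℂ) :
    irrep q m (casimir q) v = casimirValue q m • v := by
  have hq0 : (q : ℂ) ≠ 0 := q.ne_zero
  suffices h : irrep q m (casimir q) = casimirValue q m • LinearMap.id from
    LinearMap.congr_fun h v
  refine irrep_hom_ext fun j => ?_
  simp only [casimir, map_add, map_smul, map_mul, LinearMap.add_apply, LinearMap.smul_apply,
    Module.End.mul_apply, LinearMap.id_apply, irrep_K, irrep_Kinv, casimirValue]
  rcases j with _ | j
  · rw [irrep_E_zero, map_zero, smul_zero]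
    match_scalars
    simp only [mul_zero, sub_zero, zpow_neg, zpow_natCast]
    field_simp
    ring
  · rw [irrep_E_succ, map_smul, irrep_F]
    match_scalars
    have h : ((q : ℂ) - (q : ℂ)⁻¹) ^ 2 * (qInt q (m - j) * qInt q (j + 1)) =
        ((q : ℂ) ^ ((m : ℤ) - j) - (q : ℂ) ^ (-((m : ℤ) - j))) *
          ((q : ℂ) ^ ((j : ℤ) + 1) - (q : ℂ) ^ (-((j : ℤ) + 1))) := by
      rw [← qInt_mul_sub_inv hq, ← qInt_mul_sub_inv hq]
      ring
    simp only [mul_one]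
    rw [h]
    simp only [neg_sub, neg_add, zpow_add₀ hq0, zpow_sub₀ hq0, zpow_neg, zpow_natCast, zpow_ofNat,
      mul_comm (2 : ℤ), zpow_mul, pow_succ, pow_zero, one_mul]
    field_simp
    ring

theorem casimirValue_injective (hq : ¬ IsOfFinOrder q) :
    Function.Injective (casimirValue q) := by
  intro m n h
  have hm : (q : ℂ) ^ (m + 1) ≠ 0 := pow_ne_zero _ q.ne_zero
  have hn : (q : ℂ) ^ (n + 1) ≠ 0 := pow_ne_zero _ q.ne_zero
  have h' : ((q : ℂ) ^ (m + 1) - (q : ℂ) ^ (n + 1)) *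
      ((q : ℂ) ^ (m + 1) * (q : ℂ) ^ (n + 1) - 1) = 0 := by
    simp only [casimirValue] at h
    field_simp at h
    linear_combination h
  rcases mul_eq_zero.1 h' with h' | h'
  · have : ((m + 1 : ℕ) : ℤ) = (n + 1 : ℕ) :=
      zpow_val_injective hq (by simpa only [zpow_natCast] using sub_eq_zero.1 h')
    omega
  · have : ((m + 1 + (n + 1) : ℕ) : ℤ) = 0 := zpow_val_injective hq <| by
      simpa only [zpow_natCast, zpow_zero, pow_add] using sub_eq_zero.1 h'
    omega

/-- The operator `φ ↦ φ(x ·)` on the dual of `U_q(𝔰𝔩₂)`. -/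
def leftShift (x : Uq q) : Module.End ℂ (UqDual q) where
  toFun φ := WithConv.toConv (φ.ofConv ∘ₗ LinearMap.mulLeft ℂ x)
  map_add' _ _ := rfl
  map_smul' _ _ := rfl

/-- The operator `φ ↦ φ(· x)` on the dual of `U_q(𝔰𝔩₂)`. -/
def rightShift (x : Uq q) : Module.End ℂ (UqDual q) where
  toFun φ := WithConv.toConv (φ.ofConv ∘ₗ LinearMap.mulRight ℂ x)
  map_add' _ _ := rfl
  map_smul' _ _ := rfl

theorem leftShift_apply (x u : Uq q) (φ : UqDual q) : leftShift x φ u = φ (x * u) := rfl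

theorem rightShift_apply (x u : Uq q) (φ : UqDual q) : rightShift x φ u = φ (u * x) := rfl

theorem commute_leftShift_rightShift (x y : Uq q) : Commute (leftShift x) (rightShift y) := by
  ext φ u
  exact congrArg φ (mul_assoc x u y)

theorem commute_leftShift {x y : Uq q} (h : Commute x y) :
    Commute (leftShift x) (leftShift y) := by
  ext φ u
  change φ (y * (x * u)) = φ (x * (y * u))
  rw [← mul_assoc, ← mul_assoc, h.eq]

theorem commute_casimir_K (q : ℂˣ) : Commute (casimir q) (Uq.gen q .K) := by
  have hq0 : (q : ℂ) ≠ 0 := q.ne_zero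
  have h : Commute (Uq.gen q .F * Uq.gen q .E) (Uq.gen q .K) := by
    refine Commute.symm ?_
    rw [Commute, SemiconjBy, ← mul_assoc, Uq.K_F, smul_mul_assoc, mul_assoc, Uq.K_E,
      mul_smul_comm, smul_smul, inv_mul_cancel₀ (pow_ne_zero 2 hq0), one_smul, mul_assoc]
  have h' : Commute (Uq.gen q .Kinv) (Uq.gen q .K) := (Uq.Kinv_K q).trans (Uq.K_Kinv q).symm
  exact ((h.smul_left _).add_left ((Commute.refl _).smul_left _)).add_left (h'.smul_left _)

/-- The matrix coefficient `u ↦ u_{ij}` of `V_m`. -/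
def irrepCoeff (q : ℂˣ) (m : ℕ) (i j : Fin (m + 1)) : UqDual q :=
  matrixCoeff (irrep q m) (LinearMap.proj i) (irrepVec m j)

theorem irrepCoeff_apply (m : ℕ) (i j : Fin (m + 1)) (u : Uq q) :
    irrepCoeff q m i j u = irrep q m u (irrepVec m j) i := rfl

theorem irrep_K_coord (m : ℕ) (i : Fin (m + 1)) (v : Fin (m + 1) → ℂ) :
    irrep q m (Uq.gen q .K) v i = (q : ℂ) ^ ((m : ℤ) - 2 * i) * v i := by
  have h : LinearMap.proj i ∘ₗ irrep q m (Uq.gen q .K) =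
      (q : ℂ) ^ ((m : ℤ) - 2 * i) • (LinearMap.proj i : (Fin (m + 1) → ℂ) →ₗ[ℂ] ℂ) := by
    refine irrep_hom_ext fun j => ?_
    rw [LinearMap.comp_apply, irrep_K]
    by_cases hj : (i : ℕ) = j
    · simp [← hj]
    · simp [irrepVec, hj]
  exact LinearMap.congr_fun h v

theorem exists_irrep_F_pow_apply_eq_smul (hq : ¬ IsOfFinOrder q) (m j k : ℕ) :
    ∃ r : ℂ, r ≠ 0 ∧ irrep q m (Uq.gen q .F ^ k) (irrepVec m j) = r • irrepVec m (j + k) := by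
  induction k with
  | zero => exact ⟨1, one_ne_zero, by simp⟩
  | succ k ih =>
    obtain ⟨r, hr, h⟩ := ih
    refine ⟨r * qInt q ((j + k : ℕ) + 1), mul_ne_zero hr (qInt_ne_zero hq (by omega)), ?_⟩
    rw [pow_succ', map_mul, Module.End.mul_apply, h, map_smul, irrep_F, smul_smul]
    rfl

theorem exists_irrep_E_pow_apply_eq_smul (hq : ¬ IsOfFinOrder q) (m j k : ℕ) (h : j + k ≤ m) :
    ∃ r : ℂ, r ≠ 0 ∧ irrep q m (Uq.gen q .E ^ k) (irrepVec m (j + k)) = r • irrepVec m j := by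
  induction k with
  | zero => exact ⟨1, one_ne_zero, by simp⟩
  | succ k ih =>
    obtain ⟨r, hr, h'⟩ := ih (by omega)
    refine ⟨qInt q (m - (j + k : ℕ)) * r, mul_ne_zero (qInt_ne_zero hq (by omega)) hr, ?_⟩
    rw [pow_succ, map_mul, Module.End.mul_apply, ← add_assoc, irrep_E_succ, map_smul, h',
      smul_smul]

theorem irrepCoeff_ne_zero (hq : ¬ IsOfFinOrder q) (m : ℕ) (i j : Fin (m + 1)) :
    irrepCoeff q m i j ≠ 0 := by
  suffices h : ∃ u, ∃ r : ℂ, r ≠ 0 ∧ irrep q m u (irrepVec m j) = r • irrepVec m i by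
    obtain ⟨u, r, hr, h⟩ := h
    intro h₀
    have h₁ : irrepCoeff q m i j u = 0 := by rw [h₀]; rfl
    rw [irrepCoeff_apply, h] at h₁
    exact hr (by simpa [irrepVec] using h₁)
  rcases le_total (j : ℕ) i with h | h <;> obtain ⟨k, hk⟩ := Nat.exists_eq_add_of_le h
  · rw [hk]
    exact ⟨_, exists_irrep_F_pow_apply_eq_smul hq m j k⟩
  · rw [hk]
    exact ⟨_, exists_irrep_E_pow_apply_eq_smul hq m i k (by omega)⟩

theorem leftShift_casimir_irrepCoeff (hq : ¬ IsOfFinOrder q) (m : ℕ)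
    (i j : Fin (m + 1)) :
    leftShift (casimir q) (irrepCoeff q m i j) = casimirValue q m • irrepCoeff q m i j := by
  ext u
  rw [leftShift_apply, irrepCoeff_apply, map_mul, Module.End.mul_apply, irrep_casimir hq]
  rfl

theorem leftShift_K_irrepCoeff (m : ℕ) (i j : Fin (m + 1)) :
    leftShift (Uq.gen q .K) (irrepCoeff q m i j) =
      (q : ℂ) ^ ((m : ℤ) - 2 * i) • irrepCoeff q m i j := by
  ext u
  rw [leftShift_apply, irrepCoeff_apply, map_mul, Module.End.mul_apply, irrep_K_coord]
  rfl

theorem rightShift_K_irrepCoeff (m : ℕ) (i j : Fin (m + 1)) :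
    rightShift (Uq.gen q .K) (irrepCoeff q m i j) =
      (q : ℂ) ^ ((m : ℤ) - 2 * j) • irrepCoeff q m i j := by
  ext u
  rw [rightShift_apply, irrepCoeff_apply, map_mul, Module.End.mul_apply, irrep_K, map_smul]
  rfl

/-- Three commuting operators on the dual of `U_q(𝔰𝔩₂)` whose joint eigenvectors include the matrix
coefficients of the modules `V_m`. -/
def cartanOp (q : ℂˣ) : Fin 3 → Module.End ℂ (UqDual q)
  | 0 => leftShift (casimir q)
  | 1 => leftShift (Uq.gen q .K)
  | 2 => rightShift (Uq.gen q .K)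

theorem commute_cartanOp (q : ℂˣ) : ∀ i j, Commute (cartanOp q i) (cartanOp q j)
  | 0, 0 | 1, 1 | 2, 2 => Commute.refl _
  | 0, 1 => commute_leftShift (commute_casimir_K q)
  | 1, 0 => (commute_leftShift (commute_casimir_K q)).symm
  | 0, 2 | 1, 2 => commute_leftShift_rightShift _ _
  | 2, 0 | 2, 1 => (commute_leftShift_rightShift _ _).symm

/-- The joint eigenvalues of the operators `cartanOp` on the matrix coefficients. -/
def cartanValue (q : ℂˣ) (x : Σ m : ℕ, Fin (m + 1) × Fin (m + 1)) : Fin 3 → ℂ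
  | 0 => casimirValue q x.1
  | 1 => (q : ℂ) ^ ((x.1 : ℤ) - 2 * x.2.1)
  | 2 => (q : ℂ) ^ ((x.1 : ℤ) - 2 * x.2.2)

theorem cartanValue_injective (hq : ¬ IsOfFinOrder q) :
    Function.Injective (cartanValue q) := by
  rintro ⟨m, i, j⟩ ⟨m', i', j'⟩ h
  obtain rfl : m = m' := casimirValue_injective hq (congrFun h 0)
  have hi : (m : ℤ) - 2 * i = m - 2 * i' := zpow_val_injective hq (congrFun h 1)
  have hj : (m : ℤ) - 2 * j = m - 2 * j' := zpow_val_injective hq (congrFun h 2)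
  obtain rfl : i = i' := Fin.ext (by omega)
  obtain rfl : j = j' := Fin.ext (by omega)
  rfl

theorem cartanOp_irrepCoeff (hq : ¬ IsOfFinOrder q)
    (x : Σ m : ℕ, Fin (m + 1) × Fin (m + 1)) : ∀ l, cartanOp q l (irrepCoeff q x.1 x.2.1 x.2.2) =
      cartanValue q x l • irrepCoeff q x.1 x.2.1 x.2.2
  | 0 => leftShift_casimir_irrepCoeff hq _ _ _
  | 1 => leftShift_K_irrepCoeff _ _ _
  | 2 => rightShift_K_irrepCoeff _ _ _

theorem linearIndependent_irrepCoeff (hq : ¬ IsOfFinOrder q) :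
    LinearIndependent ℂ
      fun x : Σ m : ℕ, Fin (m + 1) × Fin (m + 1) => irrepCoeff q x.1 x.2.1 x.2.2 :=
  linearIndependent_of_joint_eigenvectors (commute_cartanOp q) (cartanValue_injective hq)
    (cartanOp_irrepCoeff hq) fun _ => irrepCoeff_ne_zero hq _ _ _

theorem coeffSpace_irrep (q : ℂˣ) (m : ℕ) : coeffSpace (irrep q m) =
    Submodule.span ℂ (Set.range fun x : Fin (m + 1) × Fin (m + 1) => irrepCoeff q m x.1 x.2) := by
  have h (i j : Fin (m + 1)) : irrepCoeff q m i j = matrixCoeff (irrep q m)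
      ((Pi.basisFun ℂ (Fin (m + 1))).dualBasis i) (Pi.basisFun ℂ (Fin (m + 1)) j) := by
    rw [irrepCoeff, irrepVec_fin, Pi.basisFun_apply, Module.Basis.coe_dualBasis]
    rfl
  rw [coeffSpace_eq_span _ (Pi.basisFun ℂ (Fin (m + 1))).dualBasis.span_eq
    (Pi.basisFun ℂ (Fin (m + 1))).span_eq, Set.image2_range]
  simp only [h]

end MatrixCoefficients

section FusionRule

variable {k A : Type*} [CommSemiring k] [Semiring A] [Algebra k A] {C : ℕ → Submodule k A}

theorem le_pow_of_fusion (h₀ : C 0 = 1) (hC : ∀ m, C (m + 1) ≤ C m * C 1) (h₁ : 1 ≤ C 1 ^ 2)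
    (m r : ℕ) : C m ≤ C 1 ^ (m + 2 * r) := by
  have h : C m ≤ C 1 ^ m := by
    induction m with
    | zero => rw [h₀, pow_zero]
    | succ m ih => exact (hC m).trans (by rw [pow_succ]; gcongr)
  calc C m ≤ C 1 ^ m * 1 := by rwa [mul_one]
    _ ≤ C 1 ^ m * (C 1 ^ 2) ^ r := by gcongr; exact one_le_pow_of_one_le' h₁ r
    _ = C 1 ^ (m + 2 * r) := by rw [pow_add, pow_mul]

theorem iSup_eq_pow_of_fusion (h₀ : C 0 = 1) (hC : ∀ m, C (m + 1) ≤ C m * C 1)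
    (h₁ : 1 ≤ C 1 ^ 2) (hC' : ∀ m, C (m + 1) * C 1 ≤ C (m + 2) ⊔ C m) (n : ℕ) :
    ⨆ (m : ℕ) (r : ℕ) (_ : m + 2 * r = n), C m = C 1 ^ n := by
  have hle {m r n : ℕ} (h : m + 2 * r = n) :
      C m ≤ ⨆ (m : ℕ) (r : ℕ) (_ : m + 2 * r = n), C m :=
    le_iSup_of_le m (le_iSup₂_of_le r h le_rfl)
  refine le_antisymm (iSup_le fun m => iSup₂_le fun r h => h ▸ le_pow_of_fusion h₀ hC h₁ m r) ?_
  induction n with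
  | zero => exact (pow_zero (C 1)).trans_le (h₀.ge.trans (hle (r := 0) rfl))
  | succ n ih =>
    rw [pow_succ]
    refine (mul_le_mul_left ih _).trans ?_
    simp only [Submodule.iSup_mul]
    refine iSup_le fun m => iSup₂_le fun r h => ?_
    cases m with
    | zero =>
      rw [h₀, one_mul]
      exact hle (r := r) (by omega)
    | succ m =>
      exact (hC' m).trans (sup_le (hle (r := r) (by omega)) (hle (r := r + 1) (by omega)))

end FusionRule

section PeterWeylFiltration

variable {q : ℂˣ}

theorem coeffSpace_irrep_succ_le (hq : ¬ IsOfFinOrder q) : ∀ m : ℕ,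
    coeffSpace (irrep q (m + 1)) ≤ coeffSpace (irrep q m) * coeffSpace (irrep q 1)
  | 0 => by rw [coeffSpace_irrep_zero, Submodule.one_mul]
  | m + 1 => coeffSpace_irrep_add_two_le hq m

theorem span_genCoeff (q : ℂˣ) :
    Submodule.span ℂ (Set.range (genCoeff q)) = coeffSpace (irrep q 1) := by
  have h (i j : Fin 2) : irrepCoeff q 1 i j = stdCoeff q i j := by
    rw [irrepCoeff, irrepVec_fin]
    rfl
  rw [coeffSpace_irrep]
  simp only [h]
  congr 1
  ext φ
  constructor
  · rintro ⟨g, rfl⟩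
    cases g
    exacts [⟨(0, 0), rfl⟩, ⟨(0, 1), rfl⟩, ⟨(1, 0), rfl⟩, ⟨(1, 1), rfl⟩]
  · rintro ⟨⟨i, j⟩, rfl⟩
    fin_cases i <;> fin_cases j
    exacts [⟨.a, rfl⟩, ⟨.b, rfl⟩, ⟨.c, rfl⟩, ⟨.d, rfl⟩]

theorem one_le_coeffSpace_irrep_one_sq (q : ℂˣ) : 1 ≤ coeffSpace (irrep q 1) ^ 2 := by
  have hmem g : genCoeff q g ∈ coeffSpace (irrep q 1) :=
    span_genCoeff q ▸ Submodule.subset_span ⟨g, rfl⟩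
  obtain ⟨-, -, -, -, -, -, hdet⟩ := genCoeff_rel q
  rw [Submodule.one_le, ← hdet, pow_two]
  exact sub_mem (Submodule.mul_mem_mul (hmem _) (hmem _))
    (Submodule.smul_mem _ _ (Submodule.mul_mem_mul (hmem _) (hmem _)))

theorem Weight.natCast_injective : Function.Injective (Nat.cast : ℕ → Weight) :=
  fun _ _ h => Int.ofNat_inj.1 h

theorem Weight.natCast_le_iff {m : ℕ} {n : Weight} :
    (m : Weight) ≤ n ↔ ∃ r : ℕ, ((m + 2 * r : ℕ) : Weight) = n := by
  simp only [Nat.cast_add, Nat.cast_mul, Nat.cast_ofNat, eq_comm (b := n)]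
  rfl

theorem coeffSpan_eq_iSup (q : ℂˣ) (n : Weight) :
    coeffSpan q n = ⨆ (m : ℕ) (_ : (m : Weight) ≤ n), coeffSpace (irrep q m) := by
  refine le_antisymm (Submodule.span_le.2 ?_) (iSup₂_le fun m h => coeffSpace_le_iff.2 fun f v =>
    Submodule.subset_span ⟨m, h, f, v, rfl⟩)
  rintro _ ⟨m, hm, f, v, rfl⟩
  exact Submodule.mem_iSup_of_mem m
    (Submodule.mem_iSup_of_mem hm (matrixCoeff_mem_coeffSpace _ f v))

theorem coeffSpan_natCast (hq : ¬ IsOfFinOrder q) (n : ℕ) :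
    coeffSpan q n = coeffSpace (irrep q 1) ^ n := by
  rw [coeffSpan_eq_iSup, ← iSup_eq_pow_of_fusion (C := fun m => coeffSpace (irrep q m))
    coeffSpace_irrep_zero (coeffSpace_irrep_succ_le hq) (one_le_coeffSpace_irrep_one_sq q)
    (coeffSpace_irrep_mul_one_le hq) n]
  simp only [Weight.natCast_le_iff, Weight.natCast_injective.eq_iff, iSup_exists]

theorem coeffSpan_eq_bot {n : Weight} (h : n ∉ Set.range (Nat.cast : ℕ → Weight)) :
    coeffSpan q n = ⊥ := by
  rw [coeffSpan_eq_iSup, ← le_bot_iff]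
  refine iSup₂_le fun m hm => absurd ?_ h
  obtain ⟨r, hr⟩ := Weight.natCast_le_iff.1 hm
  exact ⟨_, hr⟩

theorem coeffSpan_mono : Monotone (coeffSpan q) := by
  intro m n h
  rw [coeffSpan_eq_iSup, coeffSpan_eq_iSup]
  exact biSup_mono fun _ hl => hl.trans h

theorem coeffSpan_mul_le (hq : ¬ IsOfFinOrder q) (i j : Weight) :
    coeffSpan q i * coeffSpan q j ≤ coeffSpan q (i + j) := by
  by_cases hi : i ∈ Set.range (Nat.cast : ℕ → Weight)
  · by_cases hj : j ∈ Set.range (Nat.cast : ℕ → Weight)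
    · obtain ⟨i, rfl⟩ := hi
      obtain ⟨j, rfl⟩ := hj
      rw [← Nat.cast_add, coeffSpan_natCast hq, coeffSpan_natCast hq, coeffSpan_natCast hq]
      exact (pow_add (coeffSpace (irrep q 1)) i j).ge
    · simp [coeffSpan_eq_bot hj]
  · simp [coeffSpan_eq_bot hi]

theorem isRingFiltration_peterWeyl (hq : ¬ IsOfFinOrder q) :
    IsRingFiltration (peterWeyl q) (filtrationLT (peterWeyl q)) where
  mono _ _ h := Submodule.comap_mono (coeffSpan_mono h)
  is_le h := le_iSup₂_of_le _ h le_rfl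
  is_sup _ _ h := iSup₂_le h
  one_mem := by
    have h : (1 : UqDual q) ∈ coeffSpan q (0 : ℕ) := by
      rw [coeffSpan_natCast hq]
      exact Submodule.one_le.1 (pow_zero (coeffSpace (irrep q 1))).ge
    simpa [peterWeyl] using h
  mul_mem i j x y hx hy := by
    change toUqDual q (x * y) ∈ coeffSpan q (i + j)
    rw [map_mul]
    exact coeffSpan_mul_le hq i j (Submodule.mul_mem_mul hx hy)

theorem map_toUqDual_span_gen_pow (hq : ¬ IsOfFinOrder q) (n : ℕ) :
    (Submodule.span ℂ (Set.range (OqFibre.gen q 1)) ^ n).map (toUqDual q).toLinearMap =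
      coeffSpan q n := by
  rw [coeffSpan_natCast hq, ← span_genCoeff, Submodule.map_pow, Submodule.map_span,
    ← Set.range_comp]
  congr 3
  exact funext fun g => toUqDual_gen q g

theorem ker_toUqDual_le_filtrationLT (q : ℂˣ) (n : Weight) :
    LinearMap.ker (toUqDual q).toLinearMap ≤ filtrationLT (peterWeyl q) n := by
  have h : n - 2 < n := by
    refine lt_of_le_of_ne ⟨1, by simp⟩ fun h => ?_
    exact Weight.natCast_injective.ne two_ne_zero (by simpa using h)
  exact (Submodule.comap_mono bot_le).trans (le_iSup₂_of_le (n - 2) h le_rfl)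

theorem peterWeyl_le_span_gen_pow_sup_filtrationLT (hq : ¬ IsOfFinOrder q) (n : ℕ) :
    peterWeyl q n ≤
      Submodule.span ℂ (Set.range (OqFibre.gen q 1)) ^ n ⊔ filtrationLT (peterWeyl q) n := by
  rw [peterWeyl, ← map_toUqDual_span_gen_pow hq, Submodule.comap_map_eq]
  exact sup_le_sup_left (ker_toUqDual_le_filtrationLT q n) _

theorem grPiece_peterWeyl_subsingleton {n : Weight}
    (h : n ∉ Set.range (Nat.cast : ℕ → Weight)) : Subsingleton (GrPiece (peterWeyl q) n) := by
  refine Submodule.Quotient.subsingleton_iff.2 (Submodule.submoduleOf_eq_top.2 ?_)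
  rw [peterWeyl, coeffSpan_eq_bot h]
  exact ker_toUqDual_le_filtrationLT q n

/-- The span of the matrix coefficients of the modules `V_m` with `m ≠ n`. -/
def coeffSpanNe (q : ℂˣ) (n : ℕ) : Submodule ℂ (UqDual q) :=
  ⨆ (m : ℕ) (_ : m ≠ n), coeffSpace (irrep q m)

theorem filtrationLT_peterWeyl_le_comap_coeffSpanNe (q : ℂˣ) (n : ℕ) :
    filtrationLT (peterWeyl q) n ≤ (coeffSpanNe q n).comap (toUqDual q).toLinearMap := by
  refine iSup₂_le fun j hj => Submodule.comap_mono ?_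
  rw [coeffSpan_eq_iSup]
  refine iSup₂_le fun m hm => le_iSup₂_of_le m ?_ le_rfl
  rintro rfl
  exact hj.not_ge hm

theorem linearIndependent_mkQ_irrepCoeff (hq : ¬ IsOfFinOrder q) (n : ℕ) :
    LinearIndependent ℂ fun x : Fin (n + 1) × Fin (n + 1) =>
      (coeffSpanNe q n).mkQ (irrepCoeff q n x.1 x.2) := by
  have hindep := linearIndependent_irrepCoeff hq
  have hle : coeffSpanNe q n ≤ Submodule.span ℂ
      ((fun x : Σ m : ℕ, Fin (m + 1) × Fin (m + 1) => irrepCoeff q x.1 x.2.1 x.2.2) ''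
        {x | x.1 ≠ n}) := by
    refine iSup₂_le fun m hm => ?_
    rw [coeffSpace_irrep]
    exact Submodule.span_mono (Set.range_subset_iff.2 fun x => ⟨⟨m, x⟩, hm, rfl⟩)
  have hdisj := hindep.disjoint_span_image (s := Set.range (Sigma.mk n)) (t := {x | x.1 ≠ n})
    (Set.disjoint_left.2 <| by rintro _ ⟨x, rfl⟩ hx; exact hx rfl)
  refine (hindep.comp (Sigma.mk n) sigma_mk_injective).map ?_
  rw [Submodule.ker_mkQ, Set.range_comp]
  exact hdisj.mono_right hle

theorem exists_toUqDual_eq_irrepCoeff (hq : ¬ IsOfFinOrder q) (n : ℕ) (i j : Fin (n + 1)) :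
    ∃ y : peterWeyl q n, toUqDual q y = irrepCoeff q n i j := by
  have h : irrepCoeff q n i j ∈ coeffSpan q n := by
    rw [coeffSpan_eq_iSup]
    exact Submodule.mem_iSup_of_mem n
      (Submodule.mem_iSup_of_mem le_rfl (matrixCoeff_mem_coeffSpace _ _ _))
  obtain ⟨y, -, hy⟩ := (map_toUqDual_span_gen_pow hq n).ge h
  exact ⟨⟨y, (hy ▸ h :)⟩, hy⟩

theorem le_rank_grPiece_peterWeyl (hq : ¬ IsOfFinOrder q) (n : ℕ) :
    (((n + 1) * (n + 1) : ℕ) : Cardinal) ≤ Module.rank ℂ (GrPiece (peterWeyl q) n) := by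
  choose y hy using fun x : Fin (n + 1) × Fin (n + 1) =>
    exists_toUqDual_eq_irrepCoeff hq n x.1 x.2
  let f : GrPiece (peterWeyl q) n →ₗ[ℂ] UqDual q ⧸ coeffSpanNe q n :=
    Submodule.mapQ _ _ ((toUqDual q).toLinearMap ∘ₗ (peterWeyl q n).subtype)
      fun _ hz => filtrationLT_peterWeyl_le_comap_coeffSpanNe q n hz
  have h : LinearIndependent ℂ fun x => grMk (peterWeyl q) n (y x) := by
    refine LinearIndependent.of_comp f ?_
    convert linearIndependent_mkQ_irrepCoeff hq n using 2 with x
    rw [← hy x]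
    rfl
  simpa using h.cardinal_le_rank

end PeterWeylFiltration

section GradedModules

variable {k A B : Type*}

theorem disjoint_ker_of_finrank_le_rank_map [DivisionRing k] [AddCommGroup A] [Module k A]
    [AddCommGroup B] [Module k B] {f : A →ₗ[k] B} {W : Submodule k A} [Module.Finite k W]
    (h : (Module.finrank k W : Cardinal) ≤ Module.rank k (W.map f)) :
    Disjoint W (LinearMap.ker f) := by
  rw [← Module.finrank_eq_rank, Nat.cast_le, ← LinearMap.range_domRestrict] at h
  have hker : Module.finrank k (LinearMap.ker (f.domRestrict W)) = 0 := by
    have := (f.domRestrict W).finrank_range_add_finrank_ker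
    omega
  rw [Submodule.finrank_eq_zero, LinearMap.ker_domRestrict] at hker
  rwa [Submodule.disjoint_iff_comap_eq_bot]

variable {κ : Type*} [Ring k] [AddCommGroup A] [Module k A] [AddCommGroup B] [Module k B]

theorem injective_of_iSupIndep_map {f : A →ₗ[k] B} {W : κ → Submodule k A}
    (hW : ⨆ n, W n = ⊤) (hindep : iSupIndep fun n => (W n).map f)
    (hdisj : ∀ n, Disjoint (W n) (LinearMap.ker f)) : Function.Injective f := by
  classical
  refine (injective_iff_map_eq_zero f).2 fun x hx => ?_
  obtain ⟨y, rfl⟩ := (Submodule.mem_iSup_iff_exists_dfinsupp' _ x).1 (hW ▸ Submodule.mem_top)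
  rw [DFinsupp.sum, map_sum] at hx
  refine Finset.sum_eq_zero fun n hn => Submodule.disjoint_def.1 (hdisj n) _ (y n).2 ?_
  exact (iSupIndep_iff_finsetSum_eq_zero_imp_eq_zero _).1 hindep y.support (fun n => f (y n))
    (fun n _ => Submodule.mem_map_of_mem (y n).2) hx n hn

theorem surjective_of_iSup_map {f : A →ₗ[k] B} {W : κ → Submodule k A}
    (h : ⨆ n, (W n).map f = ⊤) : Function.Surjective f := by
  rw [← LinearMap.range_eq_top, eq_top_iff, ← h]
  exact iSup_le fun n => LinearMap.map_le_range

end GradedModules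

section DirectSum

variable {k ι : Type*} [Ring k] [DecidableEq ι] {G : ι → Type*} [∀ i, AddCommGroup (G i)]
  [∀ i, Module k (G i)]

theorem iSupIndep_range_lof :
    iSupIndep fun i => LinearMap.range (DirectSum.lof k ι G i) := by
  refine fun i => Submodule.disjoint_def.2 ?_
  rintro _ ⟨x, rfl⟩ hx
  have hle : ⨆ (j : ι) (_ : j ≠ i), LinearMap.range (DirectSum.lof k ι G j) ≤
      LinearMap.ker (DirectSum.component k ι G i) := by
    refine iSup₂_le fun j hj => ?_
    rintro _ ⟨y, rfl⟩
    exact DirectSum.of_eq_of_ne _ _ _ hj.symm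
  have hx0 : DirectSum.component k ι G i (DirectSum.lof k ι G i x) = 0 := hle hx
  rw [← DirectSum.component.lof_self k i x, hx0, map_zero]

theorem iSup_range_lof {κ : Type*} {ν : κ → ι}
    (hν : ∀ i, i ∉ Set.range ν → Subsingleton (G i)) :
    ⨆ n, LinearMap.range (DirectSum.lof k ι G (ν n)) = ⊤ := by
  rw [eq_top_iff, ← DFinsupp.iSup_range_lsingle]
  refine iSup_le fun i => ?_
  by_cases hi : i ∈ Set.range ν
  · obtain ⟨n, rfl⟩ := hi
    exact le_iSup (fun n => LinearMap.range (DirectSum.lof k ι G (ν n))) n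
  · have := hν i hi
    rintro _ ⟨x, rfl⟩
    rw [Subsingleton.elim x 0, map_zero]
    exact zero_mem _

end DirectSum

theorem bijective_of_map_eq_range_lof {k A ι κ : Type*} [DivisionRing k] [AddCommGroup A]
    [Module k A] [DecidableEq ι] {G : ι → Type*} [∀ i, AddCommGroup (G i)] [∀ i, Module k (G i)]
    {W : κ → Submodule k A} [∀ n, Module.Finite k (W n)] (hW : ⨆ n, W n = ⊤) {ν : κ → ι}
    (hν : Function.Injective ν) (hG : ∀ i, i ∉ Set.range ν → Subsingleton (G i))
    {f : A →ₗ[k] ⨁ i, G i}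
    (hf : ∀ n, (W n).map f = LinearMap.range (DirectSum.lof k ι G (ν n)))
    (hrank : ∀ n, (Module.finrank k (W n) : Cardinal) ≤ Module.rank k (G (ν n))) :
    Function.Bijective f := by
  refine ⟨injective_of_iSupIndep_map hW ?_ fun n => disjoint_ker_of_finrank_le_rank_map ?_,
    surjective_of_iSup_map (W := W) ?_⟩
  · simp only [hf]
    exact iSupIndep_range_lof.comp hν
  · have hlof := lift_rank_range_of_injective (DirectSum.lof k ι G (ν n))
      (DirectSum.of_injective (ν n))
    rw [hf, ← Cardinal.nat_le_lift_iff, hlof, Cardinal.nat_le_lift_iff]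
    exact hrank n
  · simp only [hf]
    exact iSup_range_lof hG

section GradedAlgebras

variable {k A : Type*} [CommSemiring k] [Semiring A] [Algebra k A]

theorem iSup_span_pow_eq_top {s : Set A} (hs : Algebra.adjoin k s = ⊤) :
    ⨆ n : ℕ, Submodule.span k s ^ n = ⊤ := by
  rw [eq_top_iff]
  rintro x -
  have hx : x ∈ Algebra.adjoin k s := hs ▸ Algebra.mem_top
  have hle : ∀ n : ℕ, Submodule.span k s ^ n ≤ ⨆ n : ℕ, Submodule.span k s ^ n :=
    le_iSup fun n : ℕ => Submodule.span k s ^ n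
  induction hx using Algebra.adjoin_induction with
  | mem x hx => exact hle 1 (by rw [pow_one]; exact Submodule.subset_span hx)
  | algebraMap r => exact hle 0 (by rw [pow_zero]; exact Submodule.algebraMap_mem r)
  | add x y _ _ hx hy => exact add_mem hx hy
  | mul x y _ _ hx hy =>
    refine (?_ : (⨆ n : ℕ, Submodule.span k s ^ n) * (⨆ n : ℕ, Submodule.span k s ^ n) ≤ _)
      (Submodule.mul_mem_mul hx hy)
    simp only [Submodule.iSup_mul, Submodule.mul_iSup, ← pow_add]
    exact iSup₂_le fun m n => hle _

end GradedAlgebras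

section Symbols

variable {k A B ι κ : Type*} [CommSemiring k] [Semiring A] [Algebra k A] [Semiring B]
  [Algebra k B]
  [AddMonoid ι] {V : ι → Submodule k A} [SetLike.GradedMonoid V] {σ : ∀ i, V i →ₗ[k] B}

theorem span_pow_le_map_comap (hone : σ 0 ⟨1, SetLike.one_mem_graded V⟩ = 1)
    (hmul : ∀ i j (x : V i) (y : V j),
      σ (i + j) ⟨x * y, SetLike.mul_mem_graded x.2 y.2⟩ = σ i x * σ j y)
    {w : ι} (x : κ → V w) (n : ℕ) :
    Submodule.span k (Set.range fun j => (x j : A)) ^ n ≤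
      ((Submodule.span k (Set.range fun j => σ w (x j)) ^ n).comap (σ (n • w))).map
        (V (n • w)).subtype := by
  induction n with
  | zero =>
    rw [zero_nsmul, pow_zero, pow_zero, Submodule.one_le]
    refine ⟨⟨1, SetLike.one_mem_graded V⟩, ?_, rfl⟩
    rw [SetLike.mem_coe, Submodule.mem_comap, hone]
    exact Submodule.one_le.1 le_rfl
  | succ n ih =>
    rw [succ_nsmul, pow_succ, pow_succ]
    refine (mul_le_mul_left ih _).trans (Submodule.mul_le.2 ?_)
    have hspan : Submodule.span k (Set.range fun j => (x j : A)) ≤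
        ((Submodule.span k (Set.range fun j => σ w (x j))).comap (σ w)).map (V w).subtype :=
      Submodule.span_le.2 (Set.range_subset_iff.2 fun j =>
        ⟨x j, Submodule.subset_span ⟨j, rfl⟩, rfl⟩)
    rintro _ ⟨y, hy, rfl⟩ _ hz
    obtain ⟨z, hz', rfl⟩ := hspan hz
    refine ⟨⟨y * z, SetLike.mul_mem_graded y.2 z.2⟩, ?_, rfl⟩
    rw [SetLike.mem_coe, Submodule.mem_comap, hmul]
    exact Submodule.mul_mem_mul hy hz'

theorem span_pow_le_range (hone : σ 0 ⟨1, SetLike.one_mem_graded V⟩ = 1)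
    (hmul : ∀ i j (x : V i) (y : V j),
      σ (i + j) ⟨x * y, SetLike.mul_mem_graded x.2 y.2⟩ = σ i x * σ j y)
    {w : ι} (x : κ → V w) (n : ℕ) :
    Submodule.span k (Set.range fun j => σ w (x j)) ^ n ≤ LinearMap.range (σ (n • w)) := by
  induction n with
  | zero =>
    rw [zero_nsmul, pow_zero, Submodule.one_le]
    exact ⟨_, hone⟩
  | succ n ih =>
    rw [succ_nsmul, pow_succ]
    have hspan : Submodule.span k (Set.range fun j => σ w (x j)) ≤ LinearMap.range (σ w) :=
      Submodule.span_le.2 (Set.range_subset_iff.2 fun j => LinearMap.mem_range_self _ (x j))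
    refine (mul_le_mul' ih hspan).trans (Submodule.mul_le.2 ?_)
    rintro _ ⟨y, rfl⟩ _ ⟨z, rfl⟩
    exact ⟨_, hmul _ _ y z⟩

theorem range_eq_span_pow (hone : σ 0 ⟨1, SetLike.one_mem_graded V⟩ = 1)
    (hmul : ∀ i j (x : V i) (y : V j),
      σ (i + j) ⟨x * y, SetLike.mul_mem_graded x.2 y.2⟩ = σ i x * σ j y)
    {w : ι} (x : κ → V w) {n : ℕ}
    (h : V (n • w) ≤ Submodule.span k (Set.range fun j => (x j : A)) ^ n ⊔
      (LinearMap.ker (σ (n • w))).map (V (n • w)).subtype) :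
    LinearMap.range (σ (n • w)) = Submodule.span k (Set.range fun j => σ w (x j)) ^ n := by
  refine le_antisymm ?_ (span_pow_le_range hone hmul x n)
  rintro _ ⟨y, rfl⟩
  obtain ⟨_, hs, _, ⟨z, hz, rfl⟩, hy⟩ := Submodule.mem_sup.1 (h y.2)
  obtain ⟨s, hs', rfl⟩ := span_pow_le_map_comap hone hmul x n hs
  rw [← show s + z = y from Subtype.ext hy, map_add, LinearMap.mem_ker.1 hz, add_zero]
  exact hs'

end Symbols

section QuantumMatrices

variable {q : ℂˣ} {t : ℂ} {B : Type*} [Ring B] [Algebra ℂ B]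

/-- A quantum `2 × 2` matrix with quantum determinant `t`: its four entries, indexed by the
generators that they stand for, satisfy the defining relations of `O_q(Mat₂) / ⟨ad - qbc - t⟩`. -/
structure IsQuantumMatrix (q : ℂˣ) (t : ℂ) (f : MatGen → B) : Prop where
  a_b : f .a * f .b = (q : ℂ) • (f .b * f .a)
  a_c : f .a * f .c = (q : ℂ) • (f .c * f .a)
  b_c : f .b * f .c = f .c * f .b
  b_d : f .b * f .d = (q : ℂ) • (f .d * f .b)
  c_d : f .c * f .d = (q : ℂ) • (f .d * f .c)
  a_d_sub : f .a * f .d - f .d * f .a = ((q : ℂ) - (q : ℂ)⁻¹) • (f .b * f .c)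
  det : f .a * f .d - (q : ℂ) • (f .b * f .c) = algebraMap ℂ B t

theorem IsQuantumMatrix.map_of_graded {ι A : Type*} [AddMonoid ι] [Ring A] [Algebra ℂ A]
    {V : ι → Submodule ℂ A} [SetLike.GradedMonoid V] {σ : ∀ i, V i →ₗ[ℂ] B}
    (hmul : ∀ i j (x : V i) (y : V j),
      σ (i + j) ⟨x * y, SetLike.mul_mem_graded x.2 y.2⟩ = σ i x * σ j y)
    {w : ι} {f : MatGen → V w} {t t' : ℂ} (hf : IsQuantumMatrix q t fun g => (f g : A))
    (hdet : ∀ x : V (w + w), (x : A) = algebraMap ℂ A t → σ (w + w) x = algebraMap ℂ B t') :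
    IsQuantumMatrix q t' fun g => σ w (f g) where
  a_b := by
    rw [← hmul, ← hmul, ← map_smul]
    exact congrArg _ (Subtype.ext hf.a_b)
  a_c := by
    rw [← hmul, ← hmul, ← map_smul]
    exact congrArg _ (Subtype.ext hf.a_c)
  b_c := by
    rw [← hmul, ← hmul]
    exact congrArg _ (Subtype.ext hf.b_c)
  b_d := by
    rw [← hmul, ← hmul, ← map_smul]
    exact congrArg _ (Subtype.ext hf.b_d)
  c_d := by
    rw [← hmul, ← hmul, ← map_smul]
    exact congrArg _ (Subtype.ext hf.c_d)
  a_d_sub := by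
    rw [← hmul, ← hmul, ← hmul, ← map_smul, ← map_sub]
    exact congrArg _ (Subtype.ext hf.a_d_sub)
  det := by
    rw [← hmul, ← hmul, ← map_smul, ← map_sub]
    exact hdet _ hf.det

theorem OqFibre.lift_gen_eq_of_matRel (q : ℂˣ) (t : ℂ) {x y : FreeAlgebra ℂ MatGen}
    (h : MatRel q x y) :
    FreeAlgebra.lift ℂ (OqFibre.gen q t) x = FreeAlgebra.lift ℂ (OqFibre.gen q t) y := by
  have h' : FreeAlgebra.lift ℂ (OqFibre.gen q t) =
      (Presented.mk (FibreRel q t)).comp (Presented.mk (MatRel q)) :=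
    FreeAlgebra.hom_ext (funext fun g => by simp [OqFibre.gen, OqMat.gen])
  rw [h', AlgHom.comp_apply, AlgHom.comp_apply, Presented.mk_rel h]

theorem OqFibre.isQuantumMatrix_gen (q : ℂˣ) (t : ℂ) : IsQuantumMatrix q t (OqFibre.gen q t) where
  a_b := by simpa using OqFibre.lift_gen_eq_of_matRel q t .a_b
  a_c := by simpa using OqFibre.lift_gen_eq_of_matRel q t .a_c
  b_c := by simpa using OqFibre.lift_gen_eq_of_matRel q t .b_c
  b_d := by simpa using OqFibre.lift_gen_eq_of_matRel q t .b_d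
  c_d := by simpa using OqFibre.lift_gen_eq_of_matRel q t .c_d
  a_d_sub := by simpa using OqFibre.lift_gen_eq_of_matRel q t .a_d
  det := by simpa [qDet, OqFibre.gen] using Presented.mk_rel (FibreRel.det (q := q) (t := t))

/-- The universal property of `O_q(Mat₂) / ⟨ad - qbc - t⟩`: the algebra homomorphism that sends
the generators to the entries of a quantum matrix with quantum determinant `t`. -/
def OqFibre.lift {f : MatGen → B} (hf : IsQuantumMatrix q t f) : OqFibre q t →ₐ[ℂ] B :=
  Presented.lift
    (Presented.lift (FreeAlgebra.lift ℂ f) (by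
      obtain ⟨_, _, _, _, _, _, _⟩ := hf
      rintro _ _ (_ | _ | _ | _ | _ | _) <;> simpa))
    (by
      rintro _ _ ⟨⟩
      simpa [qDet, OqMat.gen] using hf.det)

theorem OqFibre.lift_gen {f : MatGen → B} (hf : IsQuantumMatrix q t f) (g : MatGen) :
    OqFibre.lift hf (OqFibre.gen q t g) = f g := by
  simp [OqFibre.lift, OqFibre.gen, OqMat.gen]

theorem OqFibre.adjoin_range_gen (q : ℂˣ) (t : ℂ) :
    Algebra.adjoin ℂ (Set.range (OqFibre.gen q t)) = ⊤ := by
  let f : FreeAlgebra ℂ MatGen →ₐ[ℂ] OqFibre q t :=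
    (Presented.mk (FibreRel q t)).comp (Presented.mk (MatRel q))
  have hf : Function.Surjective f := Presented.mk_surjective.comp Presented.mk_surjective
  have h := congrArg (Subalgebra.map f) (FreeAlgebra.adjoin_range_ι ℂ MatGen)
  rw [AlgHom.map_adjoin, ← Set.range_comp, Algebra.map_top, (AlgHom.range_eq_top f).2 hf] at h
  exact h

theorem OqSing.iSup_component (q : ℂˣ) : ⨆ n, OqSing.component q n = ⊤ :=
  iSup_span_pow_eq_top (OqFibre.adjoin_range_gen q 0)

theorem OqSing.map_component (f : OqSing q →ₐ[ℂ] B) (n : ℕ) :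
    (OqSing.component q n).map f.toLinearMap =
      Submodule.span ℂ (Set.range fun g => f (OqFibre.gen q 0 g)) ^ n := by
  rw [OqSing.component, Submodule.map_pow, Submodule.map_span, ← Set.range_comp]
  rfl

end QuantumMatrices

section NormalMonomials

variable {q : ℂˣ}

theorem mul_pow_of_qcommute {k A : Type*} [CommSemiring k] [Semiring A] [Algebra k A]
    {x y : A} {r : k} (h : x * y = r • (y * x)) (n : ℕ) : x * y ^ n = r ^ n • (y ^ n * x) := by
  induction n with
  | zero => simp
  | succ n ih =>
    rw [pow_succ, ← mul_assoc, ih, smul_mul_assoc, mul_assoc, h, mul_smul_comm, smul_smul,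
      mul_assoc, pow_succ]

theorem OqSing.a_d (q : ℂˣ) : OqFibre.gen q 0 .a * OqFibre.gen q 0 .d =
    (q : ℂ) • (OqFibre.gen q 0 .b * OqFibre.gen q 0 .c) := by
  simpa [sub_eq_zero] using (OqFibre.isQuantumMatrix_gen q 0).det

theorem OqSing.d_a (q : ℂˣ) : OqFibre.gen q 0 .d * OqFibre.gen q 0 .a =
    (q : ℂ)⁻¹ • (OqFibre.gen q 0 .b * OqFibre.gen q 0 .c) := by
  have h := (OqFibre.isQuantumMatrix_gen q 0).a_d_sub
  rwa [OqSing.a_d, sub_smul, sub_right_inj] at h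

theorem OqSing.d_b (q : ℂˣ) : OqFibre.gen q 0 .d * OqFibre.gen q 0 .b =
    (q : ℂ)⁻¹ • (OqFibre.gen q 0 .b * OqFibre.gen q 0 .d) := by
  rw [(OqFibre.isQuantumMatrix_gen q 0).b_d, smul_smul, inv_mul_cancel₀ q.ne_zero, one_smul]

theorem OqSing.d_c (q : ℂˣ) : OqFibre.gen q 0 .d * OqFibre.gen q 0 .c =
    (q : ℂ)⁻¹ • (OqFibre.gen q 0 .c * OqFibre.gen q 0 .d) := by
  rw [(OqFibre.isQuantumMatrix_gen q 0).c_d, smul_smul, inv_mul_cancel₀ q.ne_zero, one_smul]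

/-- The ordered monomial `b^j c^k a^i d^l`. -/
def OqSing.monomial (q : ℂˣ) (j k i l : ℕ) : OqSing q :=
  OqFibre.gen q 0 .b ^ j * OqFibre.gen q 0 .c ^ k *
    (OqFibre.gen q 0 .a ^ i * OqFibre.gen q 0 .d ^ l)

/-- The span of the ordered monomials of degree `n` that do not contain both `a` and `d`. -/
def OqSing.normalSpan (q : ℂˣ) (n : ℕ) : Submodule ℂ (OqSing q) :=
  Submodule.span ℂ
    {x | ∃ j k i l, j + k + i + l = n ∧ (i = 0 ∨ l = 0) ∧ x = OqSing.monomial q j k i l}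

theorem OqSing.monomial_mem {n j k i l : ℕ} (h : j + k + i + l = n) (h' : i = 0 ∨ l = 0) :
    OqSing.monomial q j k i l ∈ OqSing.normalSpan q n :=
  Submodule.subset_span ⟨j, k, i, l, h, h', rfl⟩

theorem OqSing.b_mul_monomial (q : ℂˣ) (j k i l : ℕ) :
    OqFibre.gen q 0 .b * OqSing.monomial q j k i l = OqSing.monomial q (j + 1) k i l := by
  simp only [OqSing.monomial, pow_succ', mul_assoc]

theorem OqSing.c_mul_monomial (q : ℂˣ) (j k i l : ℕ) :
    OqFibre.gen q 0 .c * OqSing.monomial q j k i l = OqSing.monomial q j (k + 1) i l := by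
  have h : Commute (OqFibre.gen q 0 .c) (OqFibre.gen q 0 .b) :=
    (OqFibre.isQuantumMatrix_gen q 0).b_c.symm
  simp only [OqSing.monomial, pow_succ', ← mul_assoc, (h.pow_right j).eq]

theorem OqSing.mul_bc {x : OqSing q} {r : ℂ}
    (hb : x * OqFibre.gen q 0 .b = r • (OqFibre.gen q 0 .b * x))
    (hc : x * OqFibre.gen q 0 .c = r • (OqFibre.gen q 0 .c * x)) (j k : ℕ) (y : OqSing q) :
    x * (OqFibre.gen q 0 .b ^ j * OqFibre.gen q 0 .c ^ k * y) =
      (r ^ j * r ^ k) • (OqFibre.gen q 0 .b ^ j * OqFibre.gen q 0 .c ^ k * (x * y)) := by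
  rw [← mul_assoc, ← mul_assoc, mul_pow_of_qcommute hb, smul_mul_assoc, mul_assoc (_ ^ j),
    mul_pow_of_qcommute hc, mul_smul_comm, smul_smul, smul_mul_assoc]
  simp only [mul_assoc]

theorem OqSing.bc_mul (q : ℂˣ) (j k : ℕ) (y : OqSing q) :
    OqFibre.gen q 0 .b ^ j * OqFibre.gen q 0 .c ^ k *
      (OqFibre.gen q 0 .b * OqFibre.gen q 0 .c * y) =
      OqFibre.gen q 0 .b ^ (j + 1) * OqFibre.gen q 0 .c ^ (k + 1) * y := by
  have h : Commute (OqFibre.gen q 0 .c) (OqFibre.gen q 0 .b) :=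
    (OqFibre.isQuantumMatrix_gen q 0).b_c.symm
  simp only [pow_succ, mul_assoc]
  rw [← mul_assoc (_ ^ k) (OqFibre.gen q 0 .b), (h.pow_left k).eq]
  simp only [mul_assoc]

theorem OqSing.a_mul_monomial_mem {n j k i l : ℕ} (h : j + k + i + l = n) (h' : i = 0 ∨ l = 0) :
    OqFibre.gen q 0 .a * OqSing.monomial q j k i l ∈ OqSing.normalSpan q (n + 1) := by
  rw [OqSing.monomial, OqSing.mul_bc (OqFibre.isQuantumMatrix_gen q 0).a_b
    (OqFibre.isQuantumMatrix_gen q 0).a_c]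
  refine Submodule.smul_mem _ _ ?_
  by_cases hl : l = 0
  · subst hl
    rw [← mul_assoc (OqFibre.gen q 0 .a), ← pow_succ']
    exact OqSing.monomial_mem (by omega) (.inr rfl)
  · obtain rfl : i = 0 := h'.resolve_right hl
    obtain ⟨l, rfl⟩ := Nat.exists_eq_succ_of_ne_zero hl
    rw [pow_zero, one_mul, pow_succ', ← mul_assoc (OqFibre.gen q 0 .a), OqSing.a_d,
      smul_mul_assoc, mul_smul_comm, OqSing.bc_mul]
    refine Submodule.smul_mem _ _ ?_
    have := OqSing.monomial_mem (q := q) (n := n + 1) (j := j + 1) (k := k + 1) (i := 0) (l := l)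
      (by omega) (.inl rfl)
    rwa [OqSing.monomial, pow_zero, one_mul] at this

theorem OqSing.d_mul_monomial_mem {n j k i l : ℕ} (h : j + k + i + l = n) (h' : i = 0 ∨ l = 0) :
    OqFibre.gen q 0 .d * OqSing.monomial q j k i l ∈ OqSing.normalSpan q (n + 1) := by
  rw [OqSing.monomial, OqSing.mul_bc (OqSing.d_b q) (OqSing.d_c q)]
  refine Submodule.smul_mem _ _ ?_
  by_cases hi : i = 0
  · subst hi
    rw [pow_zero, one_mul, ← pow_succ']
    have := OqSing.monomial_mem (q := q) (n := n + 1) (j := j) (k := k) (i := 0) (l := l + 1)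
      (by omega) (.inl rfl)
    rwa [OqSing.monomial, pow_zero, one_mul] at this
  · obtain rfl : l = 0 := h'.resolve_left hi
    obtain ⟨i, rfl⟩ := Nat.exists_eq_succ_of_ne_zero hi
    rw [pow_succ', ← mul_assoc (OqFibre.gen q 0 .d), ← mul_assoc (OqFibre.gen q 0 .d),
      OqSing.d_a, smul_mul_assoc, smul_mul_assoc, mul_smul_comm,
      mul_assoc (OqFibre.gen q 0 .b * _), OqSing.bc_mul]
    refine Submodule.smul_mem _ _ ?_
    exact OqSing.monomial_mem (by omega) (.inr rfl)

theorem OqSing.gen_mul_monomial_mem (g : MatGen) {n j k i l : ℕ} (h : j + k + i + l = n)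
    (h' : i = 0 ∨ l = 0) :
    OqFibre.gen q 0 g * OqSing.monomial q j k i l ∈ OqSing.normalSpan q (n + 1) := by
  cases g
  · exact OqSing.a_mul_monomial_mem h h'
  · rw [OqSing.b_mul_monomial]
    exact OqSing.monomial_mem (by omega) h'
  · rw [OqSing.c_mul_monomial]
    exact OqSing.monomial_mem (by omega) h'
  · exact OqSing.d_mul_monomial_mem h h'

theorem OqSing.component_le_normalSpan (q : ℂˣ) (n : ℕ) :
    OqSing.component q n ≤ OqSing.normalSpan q n := by
  induction n with
  | zero =>
    rw [OqSing.component, pow_zero, Submodule.one_le]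
    have := OqSing.monomial_mem (q := q) (n := 0) (j := 0) (k := 0) (i := 0) (l := 0) rfl (.inl rfl)
    simpa [OqSing.monomial] using this
  | succ n ih =>
    rw [OqSing.component, pow_succ']
    refine (mul_le_mul_right ih _).trans ?_
    rw [OqSing.normalSpan, Submodule.span_mul_span, Submodule.span_le]
    rintro _ ⟨_, ⟨g, rfl⟩, _, ⟨j, k, i, l, h, h', rfl⟩, rfl⟩
    exact OqSing.gen_mul_monomial_mem g h h'

/-- The normal monomials of degree `n`, indexed by the pairs `(r, s)` with `r, s ≤ n`:
`b^j c^k a^i d^l` with `i = 0` or `l = 0` is recovered from its `x`-degree `r = j + i` and its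
`u`-degree `s = k + i` in the Segre product. The subtractions are meant to be truncated. -/
def OqSing.normalMonomial (q : ℂˣ) (n r s : ℕ) : OqSing q :=
  OqSing.monomial q (min r (n - s)) (min s (n - r)) (r + s - n) (n - r - s)

theorem OqSing.normalSpan_le_span_range (q : ℂˣ) (n : ℕ) : OqSing.normalSpan q n ≤
    Submodule.span ℂ (Set.range fun x : Fin (n + 1) × Fin (n + 1) =>
      OqSing.normalMonomial q n x.1 x.2) := by
  refine Submodule.span_mono ?_
  rintro _ ⟨j, k, i, l, h, h', rfl⟩
  refine ⟨(⟨j + i, by omega⟩, ⟨k + i, by omega⟩), ?_⟩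
  simp only [OqSing.normalMonomial]
  congr 1 <;> omega

instance OqSing.finite_normalSpan (q : ℂˣ) (n : ℕ) :
    Module.Finite ℂ (OqSing.normalSpan q n) :=
  have := Module.Finite.span_of_finite ℂ (Set.finite_range
    fun x : Fin (n + 1) × Fin (n + 1) => OqSing.normalMonomial q n x.1 x.2)
  Submodule.finiteDimensional_of_le (OqSing.normalSpan_le_span_range q n)

instance OqSing.finite_component (q : ℂˣ) (n : ℕ) : Module.Finite ℂ (OqSing.component q n) :=
  Submodule.finiteDimensional_of_le (OqSing.component_le_normalSpan q n)

theorem OqSing.finrank_component_le (q : ℂˣ) (n : ℕ) :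
    Module.finrank ℂ (OqSing.component q n) ≤ (n + 1) * (n + 1) := by
  have := Module.Finite.span_of_finite ℂ (Set.finite_range
    fun x : Fin (n + 1) × Fin (n + 1) => OqSing.normalMonomial q n x.1 x.2)
  calc Module.finrank ℂ (OqSing.component q n)
    _ ≤ _ := Submodule.finrank_mono
      ((OqSing.component_le_normalSpan q n).trans (OqSing.normalSpan_le_span_range q n))
    _ ≤ _ := finrank_range_le_card _
    _ = (n + 1) * (n + 1) := by simp

end NormalMonomials

section PrincipalSymbol

variable {ι k A : Type*} [PartialOrder ι] [DecidableEq ι] [CommRing k] [Ring A] [Algebra k A]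
  (F : ι → Submodule k A)

/-- The map that sends an element of `F i` to its principal symbol of degree `i` in the associated
graded algebra. It agrees with `grOf F i`, bundled as a linear map. -/
def symbol (i : ι) : F i →ₗ[k] AssocGraded F :=
  DirectSum.lof k ι (GrPiece F) i ∘ₗ grMk F i

theorem range_symbol (i : ι) : LinearMap.range (symbol F i) = grComponent F i :=
  LinearMap.range_comp_of_range_eq_top _ (LinearMap.range_eq_top.2 (grMk_surjective F i))

variable {F} in
theorem symbol_eq_zero {i : ι} {x : F i} (hx : (x : A) ∈ filtrationLT F i) : symbol F i x = 0 := by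
  rw [symbol, LinearMap.comp_apply, show grMk F i x = 0 from (Submodule.Quotient.mk_eq_zero _).2 hx,
    map_zero]

variable {F} in
theorem filtrationLT_le_map_ker_symbol (hF : Monotone F) (i : ι) :
    filtrationLT F i ≤ (LinearMap.ker (symbol F i)).map (F i).subtype := fun x hx =>
  ⟨⟨x, iSup₂_le (fun _ hj => hF hj.le) hx⟩, symbol_eq_zero hx, rfl⟩

variable [AddCommMonoid ι] [IsRingFiltration F (filtrationLT F)]

theorem symbol_one : symbol F 0 ⟨1, SetLike.one_mem_graded F⟩ = 1 := rfl

theorem symbol_mul [IsOrderedCancelAddMonoid ι] (i j : ι) (x : F i) (y : F j) :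
    symbol F (i + j) ⟨x * y, SetLike.mul_mem_graded x.2 y.2⟩ = symbol F i x * symbol F j y :=
  (DirectSum.of_mul_of (A := GrPiece F) (grMk F i x) (grMk F j y)).symm

end PrincipalSymbol

section AssociatedGraded

variable (q : ℂˣ) [IsRingFiltration (peterWeyl q) (filtrationLT (peterWeyl q))]

theorem Weight.zero_lt_one_add_one : (0 : Weight) < 1 + 1 := by
  refine lt_of_le_of_ne ⟨1, by norm_num⟩ fun h => ?_
  exact Weight.natCast_injective.ne two_ne_zero.symm (by simpa [one_add_one_eq_two] using h)

/-- The symbols of `a`, `b`, `c`, `d` in degree `1`. -/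
def symbolGen (g : MatGen) : AssocGraded (peterWeyl q) :=
  symbol (peterWeyl q) 1 ⟨OqFibre.gen q 1 g, gen_mem_peterWeyl q g⟩

theorem isQuantumMatrix_symbolGen : IsQuantumMatrix q 0 (symbolGen q) := by
  refine IsQuantumMatrix.map_of_graded (f := fun g => ⟨_, gen_mem_peterWeyl q g⟩)
    (symbol_mul (peterWeyl q)) (OqFibre.isQuantumMatrix_gen q 1) fun x hx => ?_
  rw [map_one] at hx
  rw [map_zero]
  refine symbol_eq_zero (hx ▸ ?_)
  exact Submodule.mem_iSup_of_mem 0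
    (Submodule.mem_iSup_of_mem Weight.zero_lt_one_add_one (SetLike.one_mem_graded _))

/-- The morphism from `O_q(Mat₂) / ⟨ad - qbc⟩` to the associated graded algebra of the Peter–Weyl
filtration that sends each generator to its symbol. -/
def toGr : OqSing q →ₐ[ℂ] AssocGraded (peterWeyl q) :=
  OqFibre.lift (isQuantumMatrix_symbolGen q)

theorem toGr_gen (g : MatGen) : toGr q (OqFibre.gen q 0 g) = symbolGen q g :=
  OqFibre.lift_gen _ g

variable {q}

theorem map_toGr_component (hq : ¬ IsOfFinOrder q) (n : ℕ) :
    (OqSing.component q n).map (toGr q).toLinearMap = grComponent (peterWeyl q) (n : Weight) := by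
  have hmono : Monotone (peterWeyl q) := IsFiltration.mono
  have hle : peterWeyl q (n • 1) ≤ Submodule.span ℂ (Set.range (OqFibre.gen q 1)) ^ n ⊔
      (LinearMap.ker (symbol (peterWeyl q) (n • 1))).map (peterWeyl q (n • 1)).subtype := by
    refine le_trans ?_ (sup_le_sup_left (filtrationLT_le_map_ker_symbol hmono _) _)
    rw [nsmul_one]
    exact peterWeyl_le_span_gen_pow_sup_filtrationLT hq n
  have hrange := range_eq_span_pow (symbol_one _) (symbol_mul _)
    (fun g => ⟨_, gen_mem_peterWeyl q g⟩) hle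
  rw [range_symbol, nsmul_one] at hrange
  simp only [OqSing.map_component, toGr_gen, hrange, symbolGen]

theorem toGr_bijective (hq : ¬ IsOfFinOrder q) : Function.Bijective (toGr q) :=
  bijective_of_map_eq_range_lof (OqSing.iSup_component q) Weight.natCast_injective
    (fun _ => grPiece_peterWeyl_subsingleton) (map_toGr_component hq) fun n =>
      (Nat.cast_le.2 (OqSing.finrank_component_le q n)).trans (le_rank_grPiece_peterWeyl hq n)

end AssociatedGraded

section TensorProducts

variable {k A B : Type*} [CommSemiring k]

theorem range_mapIncl_span [AddCommMonoid A] [Module k A] [AddCommMonoid B] [Module k B]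
    {ι κ : Type*} (x : ι → A) (y : κ → B) :
    LinearMap.range (TensorProduct.mapIncl (Submodule.span k (Set.range x))
      (Submodule.span k (Set.range y))) =
        Submodule.span k (Set.range fun p : ι × κ => x p.1 ⊗ₜ[k] y p.2) := by
  rw [TensorProduct.range_mapIncl, Submodule.map₂_span_span, Set.image2_range]
  rfl

variable [Semiring A] [Algebra k A] [Semiring B] [Algebra k B]

theorem range_mapIncl_eq_mul (M : Submodule k A) (N : Submodule k B) :
    LinearMap.range (TensorProduct.mapIncl M N) =
      M.map (Algebra.TensorProduct.includeLeft : A →ₐ[k] A ⊗[k] B).toLinearMap *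
        N.map (Algebra.TensorProduct.includeRight : B →ₐ[k] A ⊗[k] B).toLinearMap := by
  rw [TensorProduct.range_map_eq_span_tmul, ← M.span_eq, ← N.span_eq, Submodule.map_span,
    Submodule.map_span, Submodule.span_mul_span]
  congr 1
  ext z
  simp [Set.mem_mul]

theorem range_mapIncl_pow (M : Submodule k A) (N : Submodule k B) (n : ℕ) :
    LinearMap.range (TensorProduct.mapIncl (M ^ n) (N ^ n)) =
      LinearMap.range (TensorProduct.mapIncl M N) ^ n := by
  have hcomm : Commute
      (M.map (Algebra.TensorProduct.includeLeft : A →ₐ[k] A ⊗[k] B).toLinearMap)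
      (N.map (Algebra.TensorProduct.includeRight : B →ₐ[k] A ⊗[k] B).toLinearMap) := by
    refine Submodule.mul_comm_of_commute ?_
    rintro _ ⟨x, -, rfl⟩ _ ⟨y, -, rfl⟩
    exact (Commute.one_right x).tmul (Commute.one_left y)
  rw [range_mapIncl_eq_mul, range_mapIncl_eq_mul, Submodule.map_pow, Submodule.map_pow,
    hcomm.mul_pow]

end TensorProducts

section QuantumPlane

variable (q : ℂˣ)

theorem Plane.gen_zero_mul_gen_one : Plane.gen q 0 * Plane.gen q 1 =
    (q : ℂ) • (Plane.gen q 1 * Plane.gen q 0) := by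
  simpa [Plane.gen] using Presented.mk_rel (PlaneRel.x_y (q := q))

/-- The operators by which `x = Plane.gen q 0` and `y = Plane.gen q 1` act by left multiplication
on the quantum plane, in the (expected) basis of the monomials `y^j x^i`, indexed by `(i, j)`. -/
def Plane.mulOp : Fin 2 → Module.End ℂ (ℕ × ℕ →₀ ℂ)
  | 0 => Finsupp.linearCombination ℂ fun p => Finsupp.single (p.1 + 1, p.2) ((q : ℂ) ^ p.2)
  | 1 => Finsupp.linearCombination ℂ fun p => Finsupp.single (p.1, p.2 + 1) 1

theorem Plane.mulOp_zero_single (i j : ℕ) : Plane.mulOp q 0 (Finsupp.single (i, j) 1) =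
    (q : ℂ) ^ j • Finsupp.single (i + 1, j) 1 := by
  simp [Plane.mulOp]

theorem Plane.mulOp_one_single (i j : ℕ) : Plane.mulOp q 1 (Finsupp.single (i, j) 1) =
    Finsupp.single (i, j + 1) 1 := by
  simp [Plane.mulOp]

theorem Plane.mulOp_zero_mul_mulOp_one : Plane.mulOp q 0 * Plane.mulOp q 1 =
    (q : ℂ) • (Plane.mulOp q 1 * Plane.mulOp q 0) := by
  refine Finsupp.lhom_ext' fun ⟨i, j⟩ => LinearMap.ext_ring ?_
  simp only [LinearMap.comp_apply, Finsupp.lsingle_apply, Module.End.mul_apply,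
    LinearMap.smul_apply, Plane.mulOp_zero_single, Plane.mulOp_one_single, map_smul, smul_smul,
    pow_succ']

/-- The regular representation of the quantum plane, in the basis `y^j x^i`. -/
def Plane.regularRep : Plane q →ₐ[ℂ] Module.End ℂ (ℕ × ℕ →₀ ℂ) :=
  Presented.lift (FreeAlgebra.lift ℂ (Plane.mulOp q)) (by
    rintro _ _ ⟨⟩
    simpa using Plane.mulOp_zero_mul_mulOp_one q)

theorem Plane.regularRep_gen (i : Fin 2) :
    Plane.regularRep q (Plane.gen q i) = Plane.mulOp q i := by
  simp [Plane.regularRep, Plane.gen]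

theorem Plane.regularRep_monomial (i j : ℕ) :
    Plane.regularRep q (Plane.gen q 1 ^ j * Plane.gen q 0 ^ i) (Finsupp.single (0, 0) 1) =
      Finsupp.single (i, j) 1 := by
  have hx : (Plane.mulOp q 0 ^ i) (Finsupp.single (0, 0) 1) = Finsupp.single (i, 0) 1 := by
    induction i with
    | zero => rfl
    | succ i ih =>
      rw [pow_succ', Module.End.mul_apply, ih, Plane.mulOp_zero_single, pow_zero, one_smul]
  have hy : (Plane.mulOp q 1 ^ j) (Finsupp.single (i, 0) 1) = Finsupp.single (i, j) 1 := by
    induction j with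
    | zero => rfl
    | succ j ih => rw [pow_succ', Module.End.mul_apply, ih, Plane.mulOp_one_single]
  rw [map_mul, map_pow, map_pow, Plane.regularRep_gen, Plane.regularRep_gen,
    Module.End.mul_apply, hx, hy]

theorem Plane.linearIndependent_monomial : LinearIndependent ℂ
    fun p : ℕ × ℕ => Plane.gen q 1 ^ p.2 * Plane.gen q 0 ^ p.1 := by
  refine LinearIndependent.of_comp
    (LinearMap.applyₗ (Finsupp.single (0, 0) 1) ∘ₗ (Plane.regularRep q).toLinearMap) ?_
  convert Finsupp.linearIndependent_single_one ℂ (ℕ × ℕ) using 2 with p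
  exact Plane.regularRep_monomial q p.1 p.2

theorem Plane.monomial_mem_symq (i j : ℕ) :
    Plane.gen q 1 ^ j * Plane.gen q 0 ^ i ∈ symq q (j + i) := by
  have hgen (l : Fin 2) : Plane.gen q l ∈ Submodule.span ℂ (Set.range (Plane.gen q)) :=
    Submodule.subset_span ⟨l, rfl⟩
  rw [symq, pow_add]
  exact Submodule.mul_mem_mul (Submodule.pow_mem_pow _ (hgen 1) j)
    (Submodule.pow_mem_pow _ (hgen 0) i)

theorem le_rank_symq (n : ℕ) : ((n + 1 : ℕ) : Cardinal) ≤ Module.rank ℂ (symq q n) := by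
  have hmem (i : Fin (n + 1)) : Plane.gen q 1 ^ (n - i : ℕ) * Plane.gen q 0 ^ (i : ℕ) ∈ symq q n :=
    (Nat.sub_add_cancel (Fin.is_le i)).subst (motive := fun m => _ ∈ symq q m)
      (Plane.monomial_mem_symq q i (n - i))
  have hli : LinearIndependent ℂ fun i : Fin (n + 1) => (⟨_, hmem i⟩ : symq q n) :=
    .of_comp (symq q n).subtype <| (Plane.linearIndependent_monomial q).comp
      (fun i : Fin (n + 1) => ((i : ℕ), (n - i : ℕ))) fun i j h => Fin.ext (congrArg Prod.fst h)
  simpa using hli.cardinal_le_rank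

theorem le_rank_segrePiece (n : ℕ) :
    (((n + 1) * (n + 1) : ℕ) : Cardinal) ≤ Module.rank ℂ (segrePiece q n) := by
  rw [segrePiece, rank_range_of_injective _ (TensorProduct.map_injective_of_flat_flat _ _
    (Submodule.subtype_injective _) (Submodule.subtype_injective _)), rank_tensorProduct',
    Nat.cast_mul]
  exact mul_le_mul' (le_rank_symq q n) (le_rank_symq q n)

end QuantumPlane

section Segre

/-- The index `i` of the entry `c_{ij}` that a generator stands for. -/
def MatGen.row : MatGen → Fin 2
  | .a | .b => 0
  | .c | .d => 1

/-- The index `j` of the entry `c_{ij}` that a generator stands for. -/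
def MatGen.col : MatGen → Fin 2
  | .a | .c => 0
  | .b | .d => 1

theorem MatGen.surjective_row_col :
    Function.Surjective fun g : MatGen => (g.row, g.col) := by
  rintro ⟨i, j⟩
  fin_cases i <;> fin_cases j
  exacts [⟨.a, rfl⟩, ⟨.b, rfl⟩, ⟨.c, rfl⟩, ⟨.d, rfl⟩]

variable (q : ℂˣ)

theorem isQuantumMatrix_tmul {A B : Type*} [Ring A] [Algebra ℂ A] [Ring B] [Algebra ℂ B]
    {x : Fin 2 → A} {u : Fin 2 → B} (hx : x 0 * x 1 = (q : ℂ) • (x 1 * x 0))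
    (hu : u 0 * u 1 = (q : ℂ) • (u 1 * u 0)) :
    IsQuantumMatrix q 0 fun g => x g.row ⊗ₜ[ℂ] u g.col where
  a_b := by simp [MatGen.row, MatGen.col, hu]
  a_c := by simp [MatGen.row, MatGen.col, hx, TensorProduct.smul_tmul']
  b_c := by simp [MatGen.row, MatGen.col, hx, hu, TensorProduct.smul_tmul]
  b_d := by simp [MatGen.row, MatGen.col, hx, TensorProduct.smul_tmul']
  c_d := by simp [MatGen.row, MatGen.col, hu]
  a_d_sub := by
    simp [MatGen.row, MatGen.col, hx, hu, ← TensorProduct.smul_tmul', smul_smul, sub_mul, sub_smul]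
  det := by simp [MatGen.row, MatGen.col, hx, hu]

/-- The inclusion of `Sym_q^n(ℂ²) ⊗ Sym_q^n(ℂ²)` as the component of degree `n` of the Segre
algebra. -/
def SegreAlg.of (n : ℕ) : segrePiece q n →ₗ[ℂ] SegreAlg q :=
  DirectSum.lof ℂ ℕ (fun k => segrePiece q k) n

theorem SegreAlg.of_mul (m n : ℕ) (x : segrePiece q m) (y : segrePiece q n) :
    SegreAlg.of q (m + n) ⟨x * y, SetLike.mul_mem_graded x.2 y.2⟩ =
      SegreAlg.of q m x * SegreAlg.of q n y :=
  (DirectSum.of_mul_of (A := fun k => segrePiece q k) x y).symm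

theorem isQuantumMatrix_segreGen :
    IsQuantumMatrix q 0 fun g => SegreAlg.gen q g.row g.col := by
  refine IsQuantumMatrix.map_of_graded (B := SegreAlg q) (σ := SegreAlg.of q) (SegreAlg.of_mul q)
    (f := fun g => ⟨_, gen_tmul_gen_mem q g.row g.col⟩)
    (isQuantumMatrix_tmul q (Plane.gen_zero_mul_gen_one q) (Plane.gen_zero_mul_gen_one q))
    fun x hx => ?_
  rw [map_zero] at hx ⊢
  rw [show x = 0 from Subtype.ext hx, map_zero]

/-- The morphism from `O_q(Mat₂) / ⟨ad - qbc⟩` to the Segre algebra. -/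
def toSegre : OqSing q →ₐ[ℂ] SegreAlg q :=
  OqFibre.lift (isQuantumMatrix_segreGen q)

theorem toSegre_gen (g : MatGen) :
    toSegre q (OqFibre.gen q 0 g) = SegreAlg.gen q g.row g.col :=
  OqFibre.lift_gen _ g

theorem segrePiece_eq_span_pow (n : ℕ) : segrePiece q n = Submodule.span ℂ
    (Set.range fun g : MatGen => Plane.gen q g.row ⊗ₜ[ℂ] Plane.gen q g.col) ^ n := by
  rw [segrePiece, symq, range_mapIncl_pow, range_mapIncl_span,
    ← MatGen.surjective_row_col.range_comp]
  rfl

theorem SegreAlg.component_eq_span_pow (n : ℕ) : SegreAlg.component q n =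
    Submodule.span ℂ (Set.range fun g : MatGen => SegreAlg.gen q g.row g.col) ^ n := by
  suffices h : LinearMap.range (SegreAlg.of q (n • 1)) =
      Submodule.span ℂ (Set.range fun g : MatGen => SegreAlg.gen q g.row g.col) ^ n by
    rwa [smul_eq_mul, mul_one] at h
  refine range_eq_span_pow (B := SegreAlg q) (σ := SegreAlg.of q) rfl (SegreAlg.of_mul q)
    (fun g : MatGen => ⟨_, gen_tmul_gen_mem q g.row g.col⟩) ?_
  refine le_trans (le_of_eq ?_) le_sup_left
  rw [segrePiece_eq_span_pow, smul_eq_mul, mul_one]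

theorem map_toSegre_component (n : ℕ) :
    (OqSing.component q n).map (toSegre q).toLinearMap = SegreAlg.component q n := by
  refine (OqSing.map_component (B := SegreAlg q) (toSegre q) n).trans ?_
  simp only [toSegre_gen]
  exact (SegreAlg.component_eq_span_pow q n).symm

theorem toSegre_bijective : Function.Bijective (toSegre q) :=
  bijective_of_map_eq_range_lof (OqSing.iSup_component q) Function.injective_id
    (fun n hn => absurd ⟨n, rfl⟩ hn) (map_toSegre_component q)
    fun n => (Nat.cast_le.2 (OqSing.finrank_component_le q n)).trans (le_rank_segrePiece q n)

end Segre

end QuantumSL2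

end

theorem mainTheorem6 (q : ℂˣ) (hq : ∀ n : ℕ, 0 < n → q ^ n ≠ 1) :
    ∃ _ : IsRingFiltration (QuantumSL2.peterWeyl q)
        (QuantumSL2.filtrationLT (QuantumSL2.peterWeyl q)),
      ∃ (e₁ : QuantumSL2.AssocGraded (QuantumSL2.peterWeyl q) ≃ₐ[ℂ] QuantumSL2.OqSing q)
        (e₂ : QuantumSL2.OqSing q ≃ₐ[ℂ] QuantumSL2.SegreAlg q),
        (∀ g : QuantumSL2.MatGen,
          e₁ (QuantumSL2.grOf (QuantumSL2.peterWeyl q) 1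
            ⟨QuantumSL2.OqFibre.gen q 1 g, QuantumSL2.gen_mem_peterWeyl q g⟩) =
              QuantumSL2.OqFibre.gen q 0 g) ∧
        (∀ n : ℕ,
          (QuantumSL2.grComponent (QuantumSL2.peterWeyl q) (n : QuantumSL2.Weight)).map
            e₁.toLinearMap = QuantumSL2.OqSing.component q n) ∧
        e₂ (QuantumSL2.OqFibre.gen q 0 .a) = QuantumSL2.SegreAlg.gen q 0 0 ∧
        e₂ (QuantumSL2.OqFibre.gen q 0 .b) = QuantumSL2.SegreAlg.gen q 0 1 ∧
        e₂ (QuantumSL2.OqFibre.gen q 0 .c) = QuantumSL2.SegreAlg.gen q 1 0 ∧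
        e₂ (QuantumSL2.OqFibre.gen q 0 .d) = QuantumSL2.SegreAlg.gen q 1 1 ∧
        (∀ n : ℕ, (QuantumSL2.OqSing.component q n).map e₂.toLinearMap =
          QuantumSL2.SegreAlg.component q n) := by
  have hq' : ¬ IsOfFinOrder q := fun h =>
    let ⟨n, hn, hqn⟩ := isOfFinOrder_iff_pow_eq_one.1 h
    hq n hn hqn
  have hF := QuantumSL2.isRingFiltration_peterWeyl hq'
  let e := AlgEquiv.ofBijective (QuantumSL2.toGr q) (QuantumSL2.toGr_bijective hq')
  exact ⟨hF, e.symm,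
    AlgEquiv.ofBijective (QuantumSL2.toSegre q) (QuantumSL2.toSegre_bijective q),
    fun g => e.symm_apply_eq.2 (QuantumSL2.toGr_gen q g).symm,
    fun n => (Submodule.map_symm_eq_iff e.toLinearEquiv).2 (QuantumSL2.map_toGr_component hq' n),
    QuantumSL2.toSegre_gen q .a, QuantumSL2.toSegre_gen q .b, QuantumSL2.toSegre_gen q .c,
    QuantumSL2.toSegre_gen q .d, QuantumSL2.map_toSegre_component q⟩
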